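/- All graphs are finite and may have loops and parallel edges. A \emph{biased graph} $\Omega=(G,\mathcal B)$ is a graph $G$ with a set $\mathcal B$ of cycles of $G$ (the \emph{balanced} cycles) such that no theta subgraph of $G$ contains exactly two cycles of $\mathcal B$. A \emph{bicycle} is a minimal edge set $X$ such that $G[X]$ is connected and contains at least two cycles. The \emph{frame matroid} $F(\Omega)$ has ground set $E(G)$, and its circuits are the balanced cycles and the bicycles that contain no balanced cycle. If $M_1,M_2$ are matroids on $E_1,E_2$ with rank functions $r_1,r_2$, and $\ell=E_1\cap E_2$ satisfies $M_1|\ell=M_2|\ell=:N$ and $r_1(\ell)=2$, then the \emph{(proper) amalgam} of $M_1$ and $M_2$ is the matroid on $E_1\cup E_2$ in which the rank of $X$ is $$\min\{\,r_1(Y\cap E_1)+r_2(Y\cap E_2)-r_N(Y\cap \ell)\ :\ X\subseteq Y\subseteq E_1\cup E_2\,\}.$$ \textbf{Lemma.} For $i=1,2$ let $\Omega_i=(G_i,\mathcal B_i)$ be a biased graph without balanced loops, and suppose that $V(G_1)\cap V(G_2)=\{u,v\}$ with $u\ne v$. Let $\ell=E(G_1)\cap E(G_2)$. Assume that every edge in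 $\ell$ has the same ends in $G_1$ as in $G_2$, that $F(\Omega_1)|\ell=F(\Omega_2)|\ell$, and that $\ell$ has rank $2$ in $F(\Omega_1)$. Assume also that, in each of $\Omega_1$ and $\Omega_2$, every vertex is incident with an unbalanced loop, and every vertex $w$ has two distinct neighbours $w_1,w_2$ (both different from $w$) such that for each $j=1,2$ there is an unbalanced $2$-edge cycle with vertices $w$ and $w_j$. Let $\Omega=(G,\mathcal B)$ be a biased graph such that $G$ has no isolated vertices (vertices incident with no edge) and $F(\Omega)$ is equal to the amalgam of $F(\Omega_1)$ and $F(\Omega_2)$. Then $G$ is isomorphic to $G_1\oplus_{uv}G_2$, the graph with vertex set $V(G_1)\cup V(G_2)$ and edge set $E(G_1)\cup E(G_2)$ in which an edge and a vertex are incident if and only if they are incident in $G_1$ or in $G_2$. -/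

import Mathlib

/-- `G.IsCycleSet C`: the set `C` is the edge set of a cycle of the multigraph `G`. A loop edge is
a cycle with one edge, and two parallel edges are a cycle with two edges. The addition `i + 1` is
cyclic, in `Fin (n + 1)`. -/
def Graph.IsCycleSet {α β : Type*} (G : Graph α β) (C : Set β) : Prop :=
  ∃ (n : ℕ) (v : Fin (n + 1) → α) (e : Fin (n + 1) → β),
    Function.Injective v ∧ Function.Injective e ∧
    (∀ i, G.IsLink (e i) (v i) (v (i + 1))) ∧ Set.range e = C

/-- `G.IsPathSet x y W P`: there is a path of `G` from `x` to `y` (no repeated vertices) with vertex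
set `W` and edge set `P`. -/
def Graph.IsPathSet {α β : Type*} (G : Graph α β) (x y : α) (W : Set α) (P : Set β) : Prop :=
  ∃ (n : ℕ) (v : Fin (n + 1) → α) (e : Fin n → β),
    Function.Injective v ∧ v 0 = x ∧ v (Fin.last n) = y ∧
    (∀ i : Fin n, G.IsLink (e i) (v i.castSucc) (v i.succ)) ∧
    Set.range v = W ∧ Set.range e = P

/-- `G.IsThetaSet T`: the set `T` is the edge set of a theta subgraph, that is, of two distinct
vertices and three pairwise internally disjoint paths joining them. -/
def Graph.IsThetaSet {α β : Type*} (G : Graph α β) (T : Set β) : Prop :=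
  ∃ (x y : α) (W : Fin 3 → Set α) (P : Fin 3 → Set β), x ≠ y ∧
    (∀ i, G.IsPathSet x y (W i) (P i)) ∧
    (∀ i j, i ≠ j → W i ∩ W j = {x, y} ∧ Disjoint (P i) (P j)) ∧
    T = ⋃ i, P i

/-- The subgraph `G[X]` induced by the edge set `X` is connected. Its vertices are the vertices
of `G` that are incident with an edge in `X`. -/
def Graph.EdgeSetConnected {α β : Type*} (G : Graph α β) (X : Set β) : Prop :=
  ∀ x y : α, (∃ e ∈ X, G.Inc e x) → (∃ e ∈ X, G.Inc e y) →
    Relation.ReflTransGen (fun a b => ∃ e ∈ X, G.IsLink e a b) x y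

/-- A bicycle: a minimal set `X` of edges such that `G[X]` is connected and contains at least two
cycles. -/
def Graph.IsBicycleSet {α β : Type*} (G : Graph α β) (X : Set β) : Prop :=
  Minimal (fun Y : Set β => Y ⊆ G.edgeSet ∧ G.EdgeSetConnected Y ∧
    ∃ C₁ C₂ : Set β, C₁ ≠ C₂ ∧ G.IsCycleSet C₁ ∧ G.IsCycleSet C₂ ∧ C₁ ⊆ Y ∧ C₂ ⊆ Y) X

/-- `G.HasIsolatedVertex`: some vertex is incident with no edge. -/
def Graph.HasIsolatedVertex {α β : Type*} (G : Graph α β) : Prop :=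
  ∃ x ∈ G.vertexSet, ∀ e, ¬ G.Inc e x

/-- An isomorphism of multigraphs: bijections of the vertices and of the edges that preserve and
reflect incidence. -/
structure GraphIso {α β γ δ : Type*} (G : Graph α β) (H : Graph γ δ) where
  vertexEquiv : G.vertexSet ≃ H.vertexSet
  edgeEquiv : G.edgeSet ≃ H.edgeSet
  inc_iff : ∀ (e : G.edgeSet) (x : G.vertexSet),
    G.Inc e x ↔ H.Inc (edgeEquiv e) (vertexEquiv x)

/-- The graph with vertex set `V(G₁) ∪ V(G₂)` and edge set `E(G₁) ∪ E(G₂)`, where an edge and a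
vertex are incident if and only if they are incident in `G₁` or in `G₂`. This is the graph
`G₁ ⊕_{uv} G₂` when `V(G₁) ∩ V(G₂) = {u, v}`. Compatibility says that the common edges have the
same ends in both graphs, so that the union is a graph. -/
def Graph.glue {α β : Type*} (G₁ G₂ : Graph α β) (h : G₁.Compatible G₂) : Graph α β where
  vertexSet := G₁.vertexSet ∪ G₂.vertexSet
  IsLink e x y := G₁.IsLink e x y ∨ G₂.IsLink e x y
  edgeSet := G₁.edgeSet ∪ G₂.edgeSet
  isLink_symm := by
    intro e _
    refine ⟨fun x y hxy => ?_⟩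
    exact hxy.imp (fun k => k.symm) (fun k => k.symm)
  eq_or_eq_of_isLink_of_isLink := by
    rintro e x y z w (h₁ | h₁) (h₂ | h₂)
    · exact h₁.left_eq_or_eq h₂
    · exact (h₁.of_compatible h h₂.edge_mem).left_eq_or_eq h₂
    · exact h₁.left_eq_or_eq (h₂.of_compatible h h₁.edge_mem)
    · exact h₁.left_eq_or_eq h₂
  edge_mem_iff_exists_isLink := by
    intro e
    simp only [Set.mem_union, Graph.edge_mem_iff_exists_isLink, exists_or]
  left_mem_of_isLink := by
    rintro e x y (k | k)
    · exact Or.inl k.left_mem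
    · exact Or.inr k.left_mem

/-- A biased graph: a graph with a linear class of cycles, the balanced cycles. A class of cycles
is linear if no theta subgraph contains exactly two of its members. -/
structure BiasedGraph (α β : Type*) where
  graph : Graph α β
  balanced : Set (Set β)
  isCycleSet_of_balanced : ∀ C ∈ balanced, graph.IsCycleSet C
  linear : ∀ T : Set β, graph.IsThetaSet T → {C | C ∈ balanced ∧ C ⊆ T}.ncard ≠ 2

/-- A ground set with a collection of subsets. A matroid on a finite ground set is given as such a
set system, the collection being that of the independent sets. -/
@[ext]
structure SetSystem (β : Type*) where
  ground : Set β
  Indep : Set β → Prop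
  subset_ground : ∀ X, Indep X → X ⊆ ground

namespace SetSystem

/-- The restriction `M|X`. -/
def restrict {β : Type*} (M : SetSystem β) (X : Set β) : SetSystem β where
  ground := X
  Indep I := M.Indep I ∧ I ⊆ X
  subset_ground _ h := h.2

/-- The rank of `X`: the maximum cardinality of an independent subset of `X`. (It is used only for
finite ground sets, where the supremum is over a bounded set.) -/
noncomputable def rank {β : Type*} (M : SetSystem β) (X : Set β) : ℕ :=
  sSup {k | ∃ I, I ⊆ X ∧ M.Indep I ∧ I.ncard = k}

/-- The rank function of the proper amalgam of `M₁` and `M₂`: with `ℓ = E₁ ∩ E₂` and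
`N = M₁|ℓ = M₂|ℓ`, the rank of `X` is the minimum of
`r₁(Y ∩ E₁) + r₂(Y ∩ E₂) - r_N(Y ∩ ℓ)` over all `Y` with `X ⊆ Y ⊆ E₁ ∪ E₂`. -/
noncomputable def amalgamRank {β : Type*} (M₁ M₂ : SetSystem β) (X : Set β) : ℤ :=
  sInf {k : ℤ | ∃ Y, X ⊆ Y ∧ Y ⊆ M₁.ground ∪ M₂.ground ∧
    k = (M₁.rank (Y ∩ M₁.ground) : ℤ) + (M₂.rank (Y ∩ M₂.ground) : ℤ)
      - ((M₁.restrict (M₁.ground ∩ M₂.ground)).rank (Y ∩ (M₁.ground ∩ M₂.ground)) : ℤ)}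

/-- The proper amalgam of `M₁` and `M₂`, on the ground set `E₁ ∪ E₂`. A set is independent if and
only if its rank is its cardinality. -/
noncomputable def properAmalgam {β : Type*} (M₁ M₂ : SetSystem β) : SetSystem β where
  ground := M₁.ground ∪ M₂.ground
  Indep X := X ⊆ M₁.ground ∪ M₂.ground ∧ amalgamRank M₁ M₂ X = (X.ncard : ℤ)
  subset_ground _ h := h.1

end SetSystem

namespace BiasedGraph

/-- The circuits of the frame matroid: the balanced cycles, and the bicycles that contain no
balanced cycle. -/
def FrameCircuit {α β : Type*} (Ω : BiasedGraph α β) (C : Set β) : Prop :=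
  C ∈ Ω.balanced ∨ (Ω.graph.IsBicycleSet C ∧ ∀ D ∈ Ω.balanced, ¬ D ⊆ C)

/-- The frame matroid `F(Ω)`: its ground set is the edge set of the graph, and a set of edges is
independent if and only if it contains no circuit. -/
def frameMatroid {α β : Type*} (Ω : BiasedGraph α β) : SetSystem β where
  ground := Ω.graph.edgeSet
  Indep X := X ⊆ Ω.graph.edgeSet ∧ ∀ C, Ω.FrameCircuit C → ¬ C ⊆ X
  subset_ground _ h := h.1

/-- The edge `e` is an unbalanced loop at the vertex `x`. -/
def IsUnbalancedLoopAt {α β : Type*} (Ω : BiasedGraph α β) (e : β) (x : α) : Prop :=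
  Ω.graph.IsLoopAt e x ∧ {e} ∉ Ω.balanced

/-- No loop edge is a balanced cycle. -/
def NoBalancedLoops {α β : Type*} (Ω : BiasedGraph α β) : Prop :=
  ∀ e x, Ω.graph.IsLoopAt e x → {e} ∉ Ω.balanced

/-- The distinct vertices `x` and `y` are the vertices of an unbalanced cycle with two edges. -/
def HasUnbalancedDigon {α β : Type*} (Ω : BiasedGraph α β) (x y : α) : Prop :=
  x ≠ y ∧ ∃ e f, e ≠ f ∧ Ω.graph.IsLink e x y ∧ Ω.graph.IsLink f x y ∧ {e, f} ∉ Ω.balanced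

end BiasedGraph

/-! The amalgam restricts to `F(Ω₁)` and `F(Ω₂)`, so the point is that each `Ωᵢ` is rigid: any frame
representation of a matroid extending `F(Ωᵢ)` contains a copy of `Gᵢ`.

Loops at `w` and `w'` together with an unbalanced digon on `w`, `w'` form a four-point line. In any
biased graph such a line lies on two vertices, since a triangle cannot be extended to it
(`isWithin_of_line`). If a loop at `w` became a link of `Ω`, the loops at two neighbours of `w`
would lie on the same two vertices as it, although three loops at distinct vertices are independent.
So loops remain loops (`exists_isLoop`). Parallel loops remain at one vertex, which defines a vertex
map, and each link is then located by its dependency with the loops at its ends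
(`exists_embedding`).

It remains to compare the embeddings of `G₁` and `G₂`. If they send `p` and `q` to the same vertex,
then loops at `p` and `q` are equal or parallel in the amalgam. By the rank formula, parallel
elements of different sides share a parallel element of `ℓ`, which forces `p = q`
(`embedding_eq_of_eq`). Since `ℓ` has rank two, the embeddings agree at `u` and `v`
(`embedding_agree`), so they combine. Without isolated vertices the combined map is onto. -/

namespace SetSystem

/-! ### Rank and parallel elements in the proper amalgam -/

variable {β : Type*} {M M₁ M₂ : SetSystem β} {X Y : Set β}

/-- The cardinalities of the independent subsets of a set are bounded. -/
theorem bddAbove_ncard_indep (hfin : M.ground.Finite) (X : Set β) :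
    BddAbove {k | ∃ I, I ⊆ X ∧ M.Indep I ∧ I.ncard = k} := by
  refine ⟨M.ground.ncard, ?_⟩
  rintro _ ⟨I, -, hI, rfl⟩
  exact Set.ncard_le_ncard (M.subset_ground I hI) hfin

theorem ncard_le_rank (hfin : M.ground.Finite) {I : Set β} (hIX : I ⊆ X) (hI : M.Indep I) :
    I.ncard ≤ M.rank X :=
  le_csSup (bddAbove_ncard_indep hfin X) ⟨I, hIX, hI, rfl⟩

theorem exists_indep_ncard_eq_rank (hfin : M.ground.Finite) (hempty : M.Indep ∅) (X : Set β) :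
    ∃ I, I ⊆ X ∧ M.Indep I ∧ I.ncard = M.rank X :=
  Nat.sSup_mem (s := {k | ∃ I, I ⊆ X ∧ M.Indep I ∧ I.ncard = k})
    ⟨0, ∅, Set.empty_subset X, hempty, Set.ncard_empty β⟩ (bddAbove_ncard_indep hfin X)

theorem rank_mono (hfin : M.ground.Finite) (hempty : M.Indep ∅) (h : X ⊆ Y) :
    M.rank X ≤ M.rank Y := by
  obtain ⟨I, hIX, hI, hcard⟩ := exists_indep_ncard_eq_rank hfin hempty X
  exact hcard ▸ ncard_le_rank hfin (hIX.trans h) hI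

/-- Translates between the rank formula that defines the amalgam and independence; no exchange axiom
is needed. -/
theorem rank_eq_ncard_iff (hfin : M.ground.Finite) (hempty : M.Indep ∅) (hX : X.Finite) :
    M.rank X = X.ncard ↔ M.Indep X := by
  obtain ⟨I, hIX, hI, hcard⟩ := exists_indep_ncard_eq_rank hfin hempty X
  constructor
  · intro h
    rwa [← Set.eq_of_subset_of_ncard_le hIX (by omega) hX]
  · intro h
    exact le_antisymm (hcard ▸ Set.ncard_le_ncard hIX hX) (ncard_le_rank hfin subset_rfl h)

theorem rank_restrict {S : Set β} (h : X ⊆ S) : (M.restrict S).rank X = M.rank X := by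
  unfold rank
  congr 1
  ext k
  constructor
  · rintro ⟨I, hIX, hI, hk⟩
    exact ⟨I, hIX, hI.1, hk⟩
  · rintro ⟨I, hIX, hI, hk⟩
    exact ⟨I, hIX, ⟨hI, hIX.trans h⟩, hk⟩

/-- The rank in the amalgam is attained as a minimum. -/
theorem amalgamRank_isLeast (hfin₁ : M₁.ground.Finite) (hempty₁ : M₁.Indep ∅)
    (hX : X ⊆ M₁.ground ∪ M₂.ground) :
    IsLeast {k : ℤ | ∃ Y, X ⊆ Y ∧ Y ⊆ M₁.ground ∪ M₂.ground ∧
      k = (M₁.rank (Y ∩ M₁.ground) : ℤ) + (M₂.rank (Y ∩ M₂.ground) : ℤ)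
        - (M₁.rank (Y ∩ (M₁.ground ∩ M₂.ground)) : ℤ)} (amalgamRank M₁ M₂ X) := by
  have hset : amalgamRank M₁ M₂ X = sInf {k : ℤ | ∃ Y, X ⊆ Y ∧ Y ⊆ M₁.ground ∪ M₂.ground ∧
      k = (M₁.rank (Y ∩ M₁.ground) : ℤ) + (M₂.rank (Y ∩ M₂.ground) : ℤ)
        - (M₁.rank (Y ∩ (M₁.ground ∩ M₂.ground)) : ℤ)} := by
    unfold amalgamRank
    simp only [rank_restrict Set.inter_subset_right]
  have hbdd : BddBelow {k : ℤ | ∃ Y, X ⊆ Y ∧ Y ⊆ M₁.ground ∪ M₂.ground ∧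
      k = (M₁.rank (Y ∩ M₁.ground) : ℤ) + (M₂.rank (Y ∩ M₂.ground) : ℤ)
        - (M₁.rank (Y ∩ (M₁.ground ∩ M₂.ground)) : ℤ)} := by
    -- An infimum over `ℤ` is attained only if bounded below; here `r_N(Y ∩ ℓ) ≤ r₁(Y ∩ E₁)`.
    refine ⟨0, ?_⟩
    rintro _ ⟨Y, -, -, rfl⟩
    have := rank_mono hfin₁ hempty₁ (X := Y ∩ (M₁.ground ∩ M₂.ground)) (Y := Y ∩ M₁.ground)
      (fun _ h => ⟨h.1, h.2.1⟩)
    omega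
  rw [hset]
  exact ⟨Int.csInf_mem ⟨_, X, subset_rfl, hX, rfl⟩ hbdd, fun k hk => csInf_le hbdd hk⟩

theorem amalgamRank_comm
    (hN : M₁.restrict (M₁.ground ∩ M₂.ground) = M₂.restrict (M₁.ground ∩ M₂.ground)) (X : Set β) :
    amalgamRank M₁ M₂ X = amalgamRank M₂ M₁ X := by
  unfold amalgamRank
  rw [hN, Set.union_comm, Set.inter_comm]
  congr 1
  ext k
  constructor <;> rintro ⟨Y, h₁, h₂, rfl⟩ <;> exact ⟨Y, h₁, h₂, by ring⟩

theorem properAmalgam_comm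
    (hN : M₁.restrict (M₁.ground ∩ M₂.ground) = M₂.restrict (M₁.ground ∩ M₂.ground)) :
    properAmalgam M₁ M₂ = properAmalgam M₂ M₁ := by
  ext X
  · simp [properAmalgam, or_comm]
  · simp only [properAmalgam, amalgamRank_comm hN, Set.union_comm M₁.ground]

theorem rank_eq_of_restrict_eq {S : Set β} (hN : M₁.restrict S = M₂.restrict S) (h : X ⊆ S) :
    M₁.rank X = M₂.rank X := by
  rw [← rank_restrict h, hN, rank_restrict h]

/-- The restriction of the amalgam to the first ground set is the first matroid. -/
theorem properAmalgam_indep_iff_left (hfin₁ : M₁.ground.Finite) (hfin₂ : M₂.ground.Finite)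
    (hempty₁ : M₁.Indep ∅) (hempty₂ : M₂.Indep ∅)
    (hN : M₁.restrict (M₁.ground ∩ M₂.ground) = M₂.restrict (M₁.ground ∩ M₂.ground))
    (hX : X ⊆ M₁.ground) : (properAmalgam M₁ M₂).Indep X ↔ M₁.Indep X := by
  have hX' : X ⊆ M₁.ground ∪ M₂.ground := hX.trans Set.subset_union_left
  have hleast := amalgamRank_isLeast hfin₁ hempty₁ hX'
  have hrank : amalgamRank M₁ M₂ X = M₁.rank X := by
    -- Taking `Y = X` cancels the last two terms, because `X ∩ E₂ ⊆ ℓ`. For any other `Y` their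
    -- difference is nonnegative.
    refine le_antisymm (hleast.2 ⟨X, subset_rfl, hX', ?_⟩) ?_
    · have h : X ∩ (M₁.ground ∩ M₂.ground) = X ∩ M₂.ground := by
        rw [← Set.inter_assoc, Set.inter_eq_left.2 hX]
      rw [rank_eq_of_restrict_eq hN Set.inter_subset_right, h, Set.inter_eq_left.2 hX]
      ring
    · obtain ⟨Y, hXY, -, hk⟩ := hleast.1
      have h₁ : M₁.rank X ≤ M₁.rank (Y ∩ M₁.ground) :=
        rank_mono hfin₁ hempty₁ (Set.subset_inter hXY hX)
      have h₂ : M₂.rank (Y ∩ (M₁.ground ∩ M₂.ground)) ≤ M₂.rank (Y ∩ M₂.ground) :=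
        rank_mono hfin₂ hempty₂ (fun _ h => ⟨h.1, h.2.2⟩)
      rw [rank_eq_of_restrict_eq hN Set.inter_subset_right] at hk
      omega
  have hXfin := hfin₁.subset hX
  simp only [properAmalgam, hX', true_and, hrank, Nat.cast_inj]
  exact rank_eq_ncard_iff hfin₁ hempty₁ hXfin

/-- If an element `e` of `M₁` and an element `f` of `M₂` are parallel in the amalgam, then both are
parallel or equal to an element of the common ground set. -/
theorem exists_parallel_of_not_indep_properAmalgam
    (hfin₁ : M₁.ground.Finite) (hfin₂ : M₂.ground.Finite)
    (hempty₁ : M₁.Indep ∅) (hempty₂ : M₂.Indep ∅)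
    (hN : M₁.restrict (M₁.ground ∩ M₂.ground) = M₂.restrict (M₁.ground ∩ M₂.ground))
    {e f : β} (he : M₁.Indep {e}) (hf : M₂.Indep {f}) (hef : e ≠ f)
    (h : ¬ (properAmalgam M₁ M₂).Indep {e, f}) :
    ∃ z ∈ M₁.ground ∩ M₂.ground, (z = e ∨ ¬ M₁.Indep {e, z}) ∧ (z = f ∨ ¬ M₂.Indep {f, z}) := by
  have he' : e ∈ M₁.ground := M₁.subset_ground _ he rfl
  have hf' : f ∈ M₂.ground := M₂.subset_ground _ hf rfl
  have hX : ({e, f} : Set β) ⊆ M₁.ground ∪ M₂.ground :=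
    Set.pair_subset (Or.inl he') (Or.inr hf')
  have hleast := amalgamRank_isLeast hfin₁ hempty₁ hX
  -- If `e` or `f` is common, both lie in one ground set, where the amalgam is already known, and
  -- the common element serves as `z`.
  by_cases hfℓ : f ∈ M₁.ground
  · exact ⟨f, ⟨hfℓ, hf'⟩, Or.inr fun hi => h <|
      (properAmalgam_indep_iff_left hfin₁ hfin₂ hempty₁ hempty₂ hN
        (Set.pair_subset he' hfℓ)).2 hi, Or.inl rfl⟩
  by_cases heℓ : e ∈ M₂.ground
  · refine ⟨e, ⟨he', heℓ⟩, Or.inl rfl, Or.inr fun hi => h ?_⟩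
    rw [properAmalgam_comm hN, Set.pair_comm]
    refine (properAmalgam_indep_iff_left hfin₂ hfin₁ hempty₂ hempty₁ ?_
      (Set.pair_subset hf' heℓ)).2 hi
    rw [Set.inter_comm, hN]
  have hle : amalgamRank M₁ M₂ {e, f} ≤ 2 := by
    refine (hleast.2 ⟨_, subset_rfl, hX, rfl⟩).trans ?_
    have h₁ : ({e, f} : Set β) ∩ M₁.ground = {e} := by
      ext x; simp only [Set.mem_inter_iff, Set.mem_insert_iff, Set.mem_singleton_iff]; grind
    have h₂ : ({e, f} : Set β) ∩ M₂.ground = {f} := by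
      ext x; simp only [Set.mem_inter_iff, Set.mem_insert_iff, Set.mem_singleton_iff]; grind
    rw [h₁, h₂, (rank_eq_ncard_iff hfin₁ hempty₁ (Set.finite_singleton e)).2 he,
      (rank_eq_ncard_iff hfin₂ hempty₂ (Set.finite_singleton f)).2 hf,
      Set.ncard_singleton, Set.ncard_singleton]
    omega
  have hne : amalgamRank M₁ M₂ {e, f} ≠ 2 := fun h2 =>
    h ⟨hX, by rw [h2, Set.ncard_pair hef]; rfl⟩
  have hpar : ∀ (M : SetSystem β), M.ground.Finite → ∀ (Y : Set β) (a z : β), a ∈ Y → z ∈ Y →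
      M.rank Y ≤ 1 → z = a ∨ ¬ M.Indep {a, z} := by
    intro M hfin Y a z ha hz hY
    by_contra! hcon
    have := ncard_le_rank hfin (Set.pair_subset ha hz) hcon.2
    rw [Set.ncard_pair hcon.1.symm] at this
    omega
  -- The minimum is at most 1. Both rank terms are at least 1 and at least `r_N(Y ∩ ℓ)`, so all
  -- three ranks equal 1. Hence `Y ∩ ℓ` supplies `z`, and everything in `Y` on either side has rank
  -- one.
  obtain ⟨Y, hXY, -, hY⟩ := hleast.1
  have heY : e ∈ Y := hXY (Or.inl rfl)
  have hfY : f ∈ Y := hXY (Or.inr rfl)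
  have h₁ : 1 ≤ M₁.rank (Y ∩ M₁.ground) := by
    simpa using ncard_le_rank hfin₁ (Set.singleton_subset_iff.2
      (show e ∈ Y ∩ M₁.ground from ⟨heY, he'⟩)) he
  have h₂ : 1 ≤ M₂.rank (Y ∩ M₂.ground) := by
    simpa using ncard_le_rank hfin₂ (Set.singleton_subset_iff.2
      (show f ∈ Y ∩ M₂.ground from ⟨hfY, hf'⟩)) hf
  have h₃ : M₁.rank (Y ∩ (M₁.ground ∩ M₂.ground)) ≤ M₁.rank (Y ∩ M₁.ground) :=
    rank_mono hfin₁ hempty₁ (fun _ h => ⟨h.1, h.2.1⟩)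
  have h₄ : M₁.rank (Y ∩ (M₁.ground ∩ M₂.ground)) ≤ M₂.rank (Y ∩ M₂.ground) := by
    rw [rank_eq_of_restrict_eq hN Set.inter_subset_right]
    exact rank_mono hfin₂ hempty₂ (fun _ h => ⟨h.1, h.2.2⟩)
  obtain ⟨I, hIY, -, hI⟩ :=
    exists_indep_ncard_eq_rank hfin₁ hempty₁ (Y ∩ (M₁.ground ∩ M₂.ground))
  obtain ⟨z, hz⟩ : I.Nonempty := by
    rw [Set.nonempty_iff_ne_empty]
    rintro rfl
    rw [Set.ncard_empty] at hI
    omega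
  obtain ⟨hzY, hz⟩ := hIY hz
  exact ⟨z, hz, hpar M₁ hfin₁ (Y ∩ M₁.ground) e z
      ⟨heY, he'⟩ ⟨hzY, hz.1⟩ (by omega),
    hpar M₂ hfin₂ (Y ∩ M₂.ground) f z
      ⟨hfY, hf'⟩ ⟨hzY, hz.2⟩ (by omega)⟩

end SetSystem

/-! ### Short cycles, and edges on two vertices -/

namespace Graph

variable {α β : Type*} {G : Graph α β}

/-- All ends of the edge `e` are among `x` and `y`. -/
def IsWithin (G : Graph α β) (e : β) (x y : α) : Prop :=
  G.IsLink e x x ∨ G.IsLink e x y ∨ G.IsLink e y y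

theorem IsWithin.symm {e : β} {x y : α} (h : G.IsWithin e x y) : G.IsWithin e y x := by
  rcases h with h | h | h
  · exact Or.inr (Or.inr h)
  · exact Or.inr (Or.inl h.symm)
  · exact Or.inl h

theorem IsWithin.edge_mem {e : β} {x y : α} (h : G.IsWithin e x y) : e ∈ G.edgeSet := by
  rcases h with h | h | h <;> exact h.edge_mem

theorem IsWithin.eq_or_eq {e : β} {x y p : α} (h : G.IsWithin e x y) (hp : G.Inc e p) :
    p = x ∨ p = y := by
  rcases h with h | h | h <;> have := hp.eq_or_eq_of_isLink h <;> tauto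

/-- A nonloop edge determines the pair of vertices that it lies within. -/
theorem IsWithin.of_isLink {e f : β} {x y p q : α} (he : G.IsWithin e x y) (hpq : p ≠ q)
    (h : G.IsLink e p q) (hf : G.IsWithin f x y) : G.IsWithin f p q := by
  rcases he.eq_or_eq h.inc_left with rfl | rfl <;> rcases he.eq_or_eq h.inc_right with rfl | rfl
  · exact absurd rfl hpq
  · exact hf
  · exact hf.symm
  · exact absurd rfl hpq

theorem IsCycleSet.nonempty {C : Set β} (h : G.IsCycleSet C) : C.Nonempty := by
  obtain ⟨n, v, e, -, -, -, rfl⟩ := h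
  exact ⟨e 0, 0, rfl⟩

theorem isCycleSet_singleton {e : β} {x : α} (h : G.IsLink e x x) : G.IsCycleSet {e} :=
  ⟨0, fun _ => x, fun _ => e, Function.injective_of_subsingleton (α := Fin 1) _,
    Function.injective_of_subsingleton (α := Fin 1) _, fun _ => h, Set.range_const⟩

theorem isCycleSet_pair {e f : β} {x y : α} (hxy : x ≠ y) (hef : e ≠ f) (he : G.IsLink e x y)
    (hf : G.IsLink f x y) : G.IsCycleSet {e, f} := by
  refine ⟨1, ![x, y], ![e, f], ?_, ?_, ?_, ?_⟩
  · intro i j h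
    fin_cases i <;> fin_cases j <;> simp_all
  · intro i j h
    fin_cases i <;> fin_cases j <;> simp_all
  · intro i
    fin_cases i
    · exact he
    · exact hf.symm
  · ext z
    simp [eq_comm, or_comm]

/-- A cycle is a loop, a digon, a triangle, or it has at least four edges. -/
theorem IsCycleSet.cases {C : Set β} (h : G.IsCycleSet C) :
    (∃ e x, G.IsLink e x x ∧ C = {e}) ∨
    (∃ e f x y, x ≠ y ∧ e ≠ f ∧ G.IsLink e x y ∧ G.IsLink f x y ∧ C = {e, f}) ∨
    (∃ a b c x y z, x ≠ y ∧ y ≠ z ∧ x ≠ z ∧ a ≠ b ∧ b ≠ c ∧ a ≠ c ∧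
      G.IsLink a x y ∧ G.IsLink b y z ∧ G.IsLink c z x ∧ C = {a, b, c}) ∨
    4 ≤ C.ncard := by
  obtain ⟨n, v, e, hv, he, hl, rfl⟩ := h
  match n, v, e, hv, he, hl with
  | 0, v, e, hv, he, hl =>
    refine Or.inl ⟨e 0, v 0, hl 0, ?_⟩
    ext z
    simp [eq_comm]
  | 1, v, e, hv, he, hl =>
    refine Or.inr (Or.inl ⟨e 0, e 1, v 0, v 1, hv.ne (by decide), he.ne (by decide), hl 0,
      (hl 1).symm, ?_⟩)
    ext z
    simp [Fin.exists_fin_two, eq_comm]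
  | 2, v, e, hv, he, hl =>
    refine Or.inr (Or.inr (Or.inl ⟨e 0, e 1, e 2, v 0, v 1, v 2, hv.ne (by decide),
      hv.ne (by decide), hv.ne (by decide), he.ne (by decide), he.ne (by decide),
      he.ne (by decide), hl 0, hl 1, hl 2, ?_⟩))
    ext z
    simp [Fin.exists_fin_succ, eq_comm]
  | n + 3, v, e, hv, he, hl =>
    refine Or.inr (Or.inr (Or.inr ?_))
    rw [Set.ncard_range_of_injective he]
    simp

/-- The form in which connectivity is used below: a vertex set that no edge of `X` leaves cannot
separate two ends of edges of `X`. -/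
theorem EdgeSetConnected.mem_of_closed {X : Set β} (h : G.EdgeSetConnected X) {S : Set α}
    (hS : ∀ e ∈ X, ∀ p q, G.IsLink e p q → p ∈ S → q ∈ S) {e f : β} {s t : α}
    (he : e ∈ X) (hes : G.Inc e s) (hs : s ∈ S) (hf : f ∈ X) (hft : G.Inc f t) : t ∈ S := by
  have hwalk := h s t ⟨e, he, hes⟩ ⟨f, hf, hft⟩
  clear hft
  induction hwalk with
  | refl => exact hs
  | tail _ hbc ih =>
    obtain ⟨a, ha, hl⟩ := hbc
    exact hS a ha _ _ hl ih

theorem edgeSetConnected_of_isWithin {X : Set β} {x y : α} (hX : ∀ e ∈ X, G.IsWithin e x y)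
    (hxy : x = y ∨ ∃ a ∈ X, G.IsLink a x y) : G.EdgeSetConnected X := by
  rintro p q ⟨e, he, hep⟩ ⟨f, hf, hfq⟩
  have hp := (hX e he).eq_or_eq hep
  have hq := (hX f hf).eq_or_eq hfq
  rcases hxy with rfl | ⟨a, ha, hl⟩
  · rw [hp.elim id id, hq.elim id id]
  · rcases hp with rfl | rfl <;> rcases hq with rfl | rfl
    · rfl
    · exact .single ⟨a, ha, hl⟩
    · exact .single ⟨a, ha, hl.symm⟩
    · rfl

end Graph

/-! ### Dependent sets of the frame matroid -/

namespace BiasedGraph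

variable {α β : Type*} {Ω : BiasedGraph α β} {X Y : Set β}

open Graph

theorem FrameCircuit.exists_isCycleSet_subset {C : Set β} (h : Ω.FrameCircuit C) :
    ∃ D, Ω.graph.IsCycleSet D ∧ D ⊆ C := by
  rcases h with h | ⟨h, -⟩
  · exact ⟨C, Ω.isCycleSet_of_balanced C h, subset_rfl⟩
  · obtain ⟨-, -, D, -, -, hD, -, hDC, -⟩ := h.prop
    exact ⟨D, hD, hDC⟩

theorem frameMatroid_indep_empty (Ω : BiasedGraph α β) : Ω.frameMatroid.Indep ∅ := by
  refine ⟨Set.empty_subset _, fun C hC h => ?_⟩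
  obtain ⟨D, hD, hDC⟩ := hC.exists_isCycleSet_subset
  obtain ⟨z, hz⟩ := hD.nonempty
  exact h (hDC hz)

theorem frameMatroid_indep_mono (h : Ω.frameMatroid.Indep Y) (hXY : X ⊆ Y) :
    Ω.frameMatroid.Indep X :=
  ⟨hXY.trans h.1, fun C hC hCX => h.2 C hC (hCX.trans hXY)⟩

/-- A connected edge set that contains two cycles is dependent. -/
theorem not_indep_of_two_cycles (hfin : X.Finite) (hconn : Ω.graph.EdgeSetConnected X)
    {C₁ C₂ : Set β} (hne : C₁ ≠ C₂) (h₁ : Ω.graph.IsCycleSet C₁) (h₂ : Ω.graph.IsCycleSet C₂)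
    (h₁X : C₁ ⊆ X) (h₂X : C₂ ⊆ X) : ¬ Ω.frameMatroid.Indep X := by
  intro hX
  let P : Set β → Prop := fun Y => Y ⊆ Ω.graph.edgeSet ∧ Ω.graph.EdgeSetConnected Y ∧
    ∃ C₁ C₂ : Set β, C₁ ≠ C₂ ∧ Ω.graph.IsCycleSet C₁ ∧ Ω.graph.IsCycleSet C₂ ∧ C₁ ⊆ Y ∧ C₂ ⊆ Y
  -- A minimal such `Y` inside `X` is a bicycle. Either it contains a balanced cycle or it is itself
  -- a circuit.
  have hs : {Y | Y ⊆ X ∧ P Y}.Finite := hfin.finite_subsets.subset fun Y hY => hY.1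
  obtain ⟨Y, -, hY⟩ := hs.exists_le_minimal
    (show X ∈ {Y | Y ⊆ X ∧ P Y} from ⟨subset_rfl, hX.1, hconn, C₁, C₂, hne, h₁, h₂, h₁X, h₂X⟩)
  have hbi : Ω.graph.IsBicycleSet Y :=
    ⟨hY.prop.2, fun Z hZ hZY => hY.le_of_le ⟨hZY.trans hY.prop.1, hZ⟩ hZY⟩
  exact hX.2 Y (Or.inr ⟨hbi, fun D hD hDY => hX.2 D (Or.inl hD) (hDY.trans hY.prop.1)⟩) hY.prop.1

theorem not_indep_loops {e f : β} {x : α} (hef : e ≠ f) (he : Ω.graph.IsLink e x x)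
    (hf : Ω.graph.IsLink f x x) : ¬ Ω.frameMatroid.Indep {e, f} := by
  refine not_indep_of_two_cycles (Set.toFinite _)
    (edgeSetConnected_of_isWithin (x := x) (y := x) ?_ (Or.inl rfl)) (C₁ := {e}) (C₂ := {f})
    (by simpa using hef) (isCycleSet_singleton he) (isCycleSet_singleton hf) (by simp) (by simp)
  rintro a (rfl | rfl)
  · exact Or.inl he
  · exact Or.inl hf

/-- Three edges on two vertices are dependent. -/
theorem not_indep_of_isWithin {a b c : β} {x y : α} (hab : a ≠ b) (hac : a ≠ c) (hbc : b ≠ c)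
    (ha : Ω.graph.IsWithin a x y) (hb : Ω.graph.IsWithin b x y) (hc : Ω.graph.IsWithin c x y) :
    ¬ Ω.frameMatroid.Indep {a, b, c} := by
  intro hI
  have hX : ∀ e ∈ ({a, b, c} : Set β), Ω.graph.IsWithin e x y := by
    rintro e (rfl | rfl | rfl) <;> assumption
  have hloops : ∀ e f : β, e ∈ ({a, b, c} : Set β) → f ∈ ({a, b, c} : Set β) → e ≠ f → ∀ p,
      Ω.graph.IsLink e p p → ¬ Ω.graph.IsLink f p p := fun e f he hf hef p hep hfp =>
    not_indep_loops hef hep hfp (frameMatroid_indep_mono hI (Set.pair_subset he hf))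
  rcases eq_or_ne x y with rfl | hxy
  · have hl : ∀ e, Ω.graph.IsWithin e x x → Ω.graph.IsLink e x x := by
      rintro e (h | h | h) <;> exact h
    exact hloops a b (by simp) (by simp) hab x (hl a ha) (hl b hb)
  -- If `e` is a link, each of the other two edges is a loop or closes a digon with `e`, which gives
  -- two cycles in a connected set. If no edge is a link, two of the three loops share a vertex.
  have key : ∀ e f g : β, e ∈ ({a, b, c} : Set β) → f ∈ ({a, b, c} : Set β) →
      g ∈ ({a, b, c} : Set β) → e ≠ f → e ≠ g → f ≠ g → ¬ Ω.graph.IsLink e x y := by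
    intro e f g he hf hg hef heg hfg hl
    have hcyc : ∀ d ∈ ({a, b, c} : Set β), e ≠ d →
        ∃ C, Ω.graph.IsCycleSet C ∧ d ∈ C ∧ C ⊆ {e, d} := by
      intro d hd hed
      rcases hX d hd with h | h | h
      · exact ⟨{d}, isCycleSet_singleton h, rfl, by simp⟩
      · exact ⟨{e, d}, isCycleSet_pair hxy hed hl h, by simp, subset_rfl⟩
      · exact ⟨{d}, isCycleSet_singleton h, rfl, by simp⟩
    obtain ⟨C, hC, hfC, hCe⟩ := hcyc f hf hef
    obtain ⟨D, hD, -, hDe⟩ := hcyc g hg heg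
    refine not_indep_of_two_cycles (Set.toFinite _)
      (edgeSetConnected_of_isWithin hX (Or.inr ⟨e, he, hl⟩)) ?_ hC hD
      (hCe.trans (Set.pair_subset he hf)) (hDe.trans (Set.pair_subset he hg)) hI
    rintro rfl
    rcases hDe hfC with h | h
    · exact hef h.symm
    · exact hfg h
  have hma : a ∈ ({a, b, c} : Set β) := by simp
  have hmb : b ∈ ({a, b, c} : Set β) := by simp
  have hmc : c ∈ ({a, b, c} : Set β) := by simp
  have hab' := hloops a b hma hmb hab
  have hac' := hloops a c hma hmc hac
  have hbc' := hloops b c hmb hmc hbc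
  rcases ha with ha | ha | ha
  · rcases hb with hb | hb | hb
    · exact hab' x ha hb
    · exact key b a c hmb hma hmc hab.symm hbc hac hb
    · rcases hc with hc | hc | hc
      · exact hac' x ha hc
      · exact key c a b hmc hma hmb hac.symm hbc.symm hab hc
      · exact hbc' y hb hc
  · exact key a b c hma hmb hmc hab hac hbc ha
  · rcases hb with hb | hb | hb
    · rcases hc with hc | hc | hc
      · exact hbc' x hb hc
      · exact key c a b hmc hma hmb hac.symm hbc.symm hab hc
      · exact hac' y ha hc
    · exact key b a c hmb hma hmc hab.symm hbc hac hb
    · exact hab' y ha hb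

end BiasedGraph

/-! ### Cycles within three edges -/

namespace Graph

variable {α β : Type*} {G : Graph α β}

/-- A cycle that contains a loop consists of this loop. -/
theorem IsCycleSet.eq_singleton {C : Set β} (h : G.IsCycleSet C) {e : β} {x : α} (heC : e ∈ C)
    (he : G.IsLink e x x) : C = {e} := by
  obtain ⟨n, v, ed, hv, -, hl, rfl⟩ := h
  obtain ⟨i, rfl⟩ := heC
  -- Both ends of a loop coincide, and cyclic succession has a fixed index only in `Fin 1`.
  have hi : i = i + 1 := by
    apply hv
    have h₁ := (hl i).left_eq_or_eq he
    have h₂ := (hl i).right_eq_or_eq he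
    rw [h₁.elim id id, h₂.elim id id]
  match n, v, ed, hv, hl, i, hi with
  | 0, v, ed, hv, hl, i, hi =>
    ext z
    have : i = 0 := Subsingleton.elim (α := Fin 1) _ _
    subst this
    simp [eq_comm]
  | n + 1, v, ed, hv, hl, i, hi =>
    simp at hi

/-- A cycle on edges of a triple, other than the whole triple, is a loop or a digon. -/
theorem IsCycleSet.cases_of_subset_triple {D : Set β} {a b c : β} (h : G.IsCycleSet D)
    (hD : D ⊆ {a, b, c}) (hne : D ≠ {a, b, c}) :
    (∃ e x, G.IsLink e x x ∧ D = {e}) ∨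
    (∃ e f x y, x ≠ y ∧ e ≠ f ∧ G.IsLink e x y ∧ G.IsLink f x y ∧ D = {e, f}) := by
  have hcard : ({a, b, c} : Set β).ncard ≤ 3 := by
    refine (Set.ncard_insert_le _ _).trans ?_
    have := Set.ncard_insert_le b ({c} : Set β)
    rw [Set.ncard_singleton] at this
    omega
  have hlt := Set.ncard_lt_ncard (hD.ssubset_of_ne hne) (Set.toFinite _)
  rcases h.cases with h | h | ⟨a', b', c', x, y, z, -, -, -, hab, hbc, hac, -, -, -, rfl⟩ | h
  · exact Or.inl h
  · exact Or.inr h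
  · have : ({a', b', c'} : Set β).ncard = 3 := Set.ncard_eq_three.2 ⟨a', b', c', hab, hac, hbc, rfl⟩
    omega
  · omega

/-- A connected triple of edges that contains a digon and a further cycle, not the whole triple,
lies on the two vertices of the digon. -/
theorem isWithin_of_digon {e f g : β} {p q : α} (hpq : p ≠ q) (hconn : G.EdgeSetConnected {e, f, g})
    (he : G.IsLink e p q) (hf : G.IsLink f p q) {D : Set β} (hD : G.IsCycleSet D)
    (hDT : D ⊆ {e, f, g}) (hne : D ≠ {e, f}) (hne' : D ≠ {e, f, g}) : G.IsWithin g p q := by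
  have hloop : ∀ d r, G.IsLink d p q → ¬ G.IsLink d r r := by
    intro d r h h'
    rcases h.eq_and_eq_or_eq_and_eq h' with h | h <;> exact hpq (h.1.trans h.2.symm)
  rcases hD.cases_of_subset_triple hDT hne' with
    ⟨d, r, hd, rfl⟩ | ⟨d, d', x, y, hxy, hdd, hd, hd', rfl⟩
  · rcases hDT rfl with rfl | rfl | rfl
    · exact absurd hd (hloop _ _ he)
    · exact absurd hd (hloop _ _ hf)
    -- The set `{p, q}` is closed: `e` and `f` link its two vertices, and the third edge is a loop.
    · have : r ∈ ({p, q} : Set α) := by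
        refine hconn.mem_of_closed ?_ (by simp) he.inc_left (by simp) (f := d) (by simp)
          hd.inc_left
        rintro h (rfl | rfl | rfl) s t hst hs
        · exact hst.right_eq_or_eq he
        · exact hst.right_eq_or_eq hf
        · have h₁ := hst.left_eq_or_eq hd
          have h₂ := hst.right_eq_or_eq hd
          rw [h₂.elim id id, ← h₁.elim id id]
          exact hs
      rcases this with rfl | rfl
      · exact Or.inl hd
      · exact Or.inr (Or.inr hd)
  · have hw : ∀ h h', G.IsLink h p q → G.IsLink h x y → G.IsLink h' x y → G.IsWithin h' p q := by
      intro h h' hl hl' hl''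
      rcases hl'.eq_and_eq_or_eq_and_eq hl with ⟨rfl, rfl⟩ | ⟨rfl, rfl⟩
      · exact Or.inr (Or.inl hl'')
      · exact Or.inr (Or.inl hl''.symm)
    rcases hDT (Or.inl rfl) with rfl | rfl | rfl
    · rcases hDT (Or.inr rfl) with rfl | rfl | rfl
      · exact absurd rfl hdd
      · exact absurd rfl hne
      · exact hw _ _ he hd hd'
    · rcases hDT (Or.inr rfl) with rfl | rfl | rfl
      · exact absurd (Set.pair_comm _ _) hne
      · exact absurd rfl hdd
      · exact hw _ _ hf hd hd'
    · rcases hDT (Or.inr rfl) with rfl | rfl | rfl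
      · exact hw _ _ he hd' hd
      · exact hw _ _ hf hd' hd
      · exact absurd rfl hdd

/-- In a connected triple of edges with loops at two distinct vertices, the third edge lies on these
vertices. -/
theorem isWithin_of_loops {e f g : β} {x y : α} (hxy : x ≠ y) (hg : g ∈ G.edgeSet)
    (hconn : G.EdgeSetConnected {e, f, g}) (he : G.IsLink e x x) (hf : G.IsLink f y y) :
    G.IsWithin g x y := by
  -- If `g` missed `x`, then `{x}` would be closed, and `y` could not be reached.
  have hinc : ∀ e f x y, x ≠ y → G.EdgeSetConnected {e, f, g} → G.IsLink e x x → G.IsLink f y y →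
      G.Inc g x := by
    intro e f x y hxy hconn he hf
    by_contra hcon
    have : y ∈ ({x} : Set α) := by
      refine hconn.mem_of_closed ?_ (Or.inl rfl) he.inc_left rfl (f := f) (by simp) hf.inc_left
      rintro h (rfl | rfl | rfl) s t hst hs
      · exact (hst.right_eq_or_eq he).elim id id
      · have h₁ := hst.left_eq_or_eq hf
        exact absurd (hs.symm.trans (h₁.elim id id)) hxy
      · have hs' : s = x := hs
        exact absurd (hs' ▸ hst.inc_left) hcon
    exact hxy this.symm
  have hx := hinc e f x y hxy hconn he hf
  have hy := hinc f e y x hxy.symm (by rwa [Set.insert_comm]) hf he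
  obtain ⟨p, hp⟩ := hx
  rcases hy.eq_or_eq_of_isLink hp with rfl | rfl
  · exact absurd rfl hxy
  · exact Or.inr (Or.inl hp)

end Graph

/-! ### Classification of dependent pairs and triples -/

namespace BiasedGraph

variable {α β : Type*} {Ω : BiasedGraph α β} {X : Set β}

open Graph

/-- A dependent pair without balanced loops consists of two loops at the same vertex, or is a
balanced digon. -/
theorem cases_of_not_indep_pair {e f : β} (hef : e ≠ f) (hX : {e, f} ⊆ Ω.graph.edgeSet)
    (he : {e} ∉ Ω.balanced) (hf : {f} ∉ Ω.balanced) (h : ¬ Ω.frameMatroid.Indep {e, f}) :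
    (∃ x, Ω.graph.IsLink e x x ∧ Ω.graph.IsLink f x x) ∨
    (∃ x y, x ≠ y ∧ Ω.graph.IsLink e x y ∧ Ω.graph.IsLink f x y ∧ {e, f} ∈ Ω.balanced) := by
  have hcyc : ∀ D, Ω.graph.IsCycleSet D → D ⊆ {e, f} → (∃ x, Ω.graph.IsLink e x x ∧ D = {e}) ∨
      (∃ x, Ω.graph.IsLink f x x ∧ D = {f}) ∨
      (∃ x y, x ≠ y ∧ Ω.graph.IsLink e x y ∧ Ω.graph.IsLink f x y ∧ D = {e, f}) := by
    intro D hD hDX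
    have hcard := Set.ncard_le_ncard hDX (Set.toFinite _)
    rw [Set.ncard_pair hef] at hcard
    rcases hD.cases with ⟨d, x, hd, rfl⟩ | ⟨d, d', x, y, hxy, hdd, hd, hd', rfl⟩ |
      ⟨a, b, c, x, y, z, -, -, -, hab, hbc, hac, -, -, -, rfl⟩ | h
    · rcases hDX rfl with rfl | rfl
      · exact Or.inl ⟨x, hd, rfl⟩
      · exact Or.inr (Or.inl ⟨x, hd, rfl⟩)
    · refine Or.inr (Or.inr ?_)
      rcases hDX (Or.inl rfl) with rfl | rfl <;> rcases hDX (Or.inr rfl) with rfl | rfl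
      · exact absurd rfl hdd
      · exact ⟨x, y, hxy, hd, hd', rfl⟩
      · exact ⟨x, y, hxy, hd', hd, Set.pair_comm _ _⟩
      · exact absurd rfl hdd
    · have : ({a, b, c} : Set β).ncard = 3 := Set.ncard_eq_three.2 ⟨a, b, c, hab, hac, hbc, rfl⟩
      omega
    · omega
  have hnl : ∀ d x y p, x ≠ y → Ω.graph.IsLink d x y → ¬ Ω.graph.IsLink d p p := by
    intro d x y p hxy h h'
    rcases h.eq_and_eq_or_eq_and_eq h' with h | h <;> exact hxy (h.1.trans h.2.symm)
  obtain ⟨C, hC, hCX⟩ : ∃ C, Ω.FrameCircuit C ∧ C ⊆ {e, f} := by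
    by_contra! hcon
    exact h ⟨hX, hcon⟩
  rcases hC with hC | ⟨hC, -⟩
  · rcases hcyc C (Ω.isCycleSet_of_balanced C hC) hCX with
      ⟨x, -, rfl⟩ | ⟨x, -, rfl⟩ | ⟨x, y, hxy, hex, hfx, rfl⟩
    · exact absurd hC he
    · exact absurd hC hf
    · exact Or.inr ⟨x, y, hxy, hex, hfx, hC⟩
  -- A digon would use both edges and leave no second cycle, so the two cycles are loops;
  -- connectivity puts them at one vertex.
  · obtain ⟨-, hconn, C₁, C₂, hne, h₁, h₂, h₁C, h₂C⟩ := hC.prop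
    have key : ∀ x y, Ω.graph.IsLink e x x → Ω.graph.IsLink f y y → e ∈ C → f ∈ C → x = y := by
      intro x y hex hfy heC hfC
      have : y ∈ ({x} : Set α) := by
        refine hconn.mem_of_closed ?_ heC hex.inc_left rfl hfC hfy.inc_left
        intro d hd s t hst hs
        rcases hCX hd with rfl | rfl
        · exact (hst.right_eq_or_eq hex).elim id id
        · have hs' := (hst.left_eq_or_eq hfy).elim id id
          have ht' := (hst.right_eq_or_eq hfy).elim id id
          rwa [ht', ← hs']
      exact this.symm
    rcases hcyc C₁ h₁ (h₁C.trans hCX) with ⟨x, hx, rfl⟩ | ⟨x, hx, rfl⟩ | ⟨x, y, hxy, hx, hx', rfl⟩ <;>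
    rcases hcyc C₂ h₂ (h₂C.trans hCX) with ⟨p, hp, rfl⟩ | ⟨p, hp, rfl⟩ | ⟨p, q, hpq, hp, hp', rfl⟩
    · exact absurd rfl hne
    · exact Or.inl ⟨x, hx, key x p hx hp (h₁C rfl) (h₂C rfl) ▸ hp⟩
    · exact absurd hx (hnl _ _ _ _ hpq hp)
    · exact Or.inl ⟨x, key p x hp hx (h₂C rfl) (h₁C rfl) ▸ hp, hx⟩
    · exact absurd rfl hne
    · exact absurd hx (hnl _ _ _ _ hpq hp')
    · exact absurd hp (hnl _ _ _ _ hxy hx)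
    · exact absurd hp (hnl _ _ _ _ hxy hx')
    · exact absurd rfl hne

/-- Unbalanced loops at distinct vertices are independent. -/
theorem indep_of_loops (hloop : ∀ e ∈ X, ∃ x, Ω.graph.IsLink e x x)
    (hbal : ∀ e ∈ X, {e} ∉ Ω.balanced)
    (hinj : ∀ e ∈ X, ∀ f ∈ X, ∀ x, Ω.graph.IsLink e x x → Ω.graph.IsLink f x x → e = f) :
    Ω.frameMatroid.Indep X := by
  have hcyc : ∀ D, Ω.graph.IsCycleSet D → D ⊆ X → ∃ e ∈ X, D = {e} := by
    intro D hD hDX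
    obtain ⟨e, he⟩ := hD.nonempty
    obtain ⟨x, hx⟩ := hloop e (hDX he)
    exact ⟨e, hDX he, hD.eq_singleton he hx⟩
  refine ⟨fun e he => (hloop e he).choose_spec.edge_mem, ?_⟩
  rintro C (hC | ⟨hC, -⟩) hCX
  · obtain ⟨e, he, rfl⟩ := hcyc C (Ω.isCycleSet_of_balanced C hC) hCX
    exact hbal e he hC
  -- A connected set of loops stays at one vertex, where `hinj` allows only one loop.
  · obtain ⟨-, hconn, C₁, C₂, hne, h₁, h₂, h₁C, h₂C⟩ := hC.prop
    obtain ⟨e, he, rfl⟩ := hcyc C₁ h₁ (h₁C.trans hCX)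
    obtain ⟨f, hf, rfl⟩ := hcyc C₂ h₂ (h₂C.trans hCX)
    obtain ⟨x, hx⟩ := hloop e he
    obtain ⟨y, hy⟩ := hloop f hf
    have : y ∈ ({x} : Set α) := by
      refine hconn.mem_of_closed ?_ (h₁C rfl) hx.inc_left rfl (h₂C rfl) hy.inc_left
      intro d hd s t hst hs
      obtain ⟨z, hz⟩ := hloop d (hCX hd)
      have hs' := (hst.left_eq_or_eq hz).elim id id
      have ht' := (hst.right_eq_or_eq hz).elim id id
      rwa [ht', ← hs']
    have hyx : y = x := this
    subst hyx
    exact hne (by rw [hinj e he f hf y hx hy])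

/-- A dependent triple of pairwise independent edges is a triangle, or lies on two vertices. -/
theorem cases_of_not_indep_triple {a b c : β} (hab : a ≠ b) (hac : a ≠ c) (hbc : b ≠ c)
    (hab' : Ω.frameMatroid.Indep {a, b}) (hac' : Ω.frameMatroid.Indep {a, c})
    (hbc' : Ω.frameMatroid.Indep {b, c}) (h : ¬ Ω.frameMatroid.Indep {a, b, c}) :
    (∃ x y z, x ≠ y ∧ y ≠ z ∧ x ≠ z ∧
      Ω.graph.IsLink a x y ∧ Ω.graph.IsLink b y z ∧ Ω.graph.IsLink c z x) ∨
    (∃ x y, Ω.graph.IsWithin a x y ∧ Ω.graph.IsWithin b x y ∧ Ω.graph.IsWithin c x y) := by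
  have hX : ({a, b, c} : Set β) ⊆ Ω.graph.edgeSet :=
    Set.insert_subset (hab'.1 (by simp)) hbc'.1
  obtain ⟨C, hC, hCX⟩ : ∃ C, Ω.FrameCircuit C ∧ C ⊆ {a, b, c} := by
    by_contra! hcon
    exact h ⟨hX, hcon⟩
  -- All pairs are independent, so the circuit is the whole triple.
  have hCeq : C = {a, b, c} := by
    refine subset_antisymm hCX ?_
    rintro d (rfl | rfl | rfl)
    · by_contra hd
      refine hbc'.2 C hC fun z hz => ?_
      rcases hCX hz with rfl | h
      · exact absurd hz hd
      · exact h
    · by_contra hd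
      refine hac'.2 C hC fun z hz => ?_
      rcases hCX hz with rfl | rfl | rfl
      · simp
      · exact absurd hz hd
      · simp
    · by_contra hd
      refine hab'.2 C hC fun z hz => ?_
      rcases hCX hz with rfl | rfl | rfl
      · simp
      · simp
      · exact absurd hz hd
  subst hCeq
  have hcard : ({a, b, c} : Set β).ncard = 3 := Set.ncard_eq_three.2 ⟨a, b, c, hab, hac, hbc, rfl⟩
  have htri : Ω.graph.IsCycleSet {a, b, c} → (∃ x y z, x ≠ y ∧ y ≠ z ∧ x ≠ z ∧
      Ω.graph.IsLink a x y ∧ Ω.graph.IsLink b y z ∧ Ω.graph.IsLink c z x) := by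
    intro hcyc
    rcases hcyc.cases with ⟨e, x, -, he⟩ | ⟨e, f, x, y, -, hef, -, -, he⟩ |
      ⟨a', b', c', x, y, z, hxy, hyz, hxz, -, -, -, ha, hb, hc, heq⟩ | h4
    · rw [he, Set.ncard_singleton] at hcard
      omega
    · rw [he, Set.ncard_pair hef] at hcard
      omega
    · have hma : a ∈ ({a', b', c'} : Set β) := heq ▸ (by simp)
      have hmb : b ∈ ({a', b', c'} : Set β) := heq ▸ (by simp)
      have hmc : c ∈ ({a', b', c'} : Set β) := heq ▸ (by simp)
      clear heq
      -- Of the assignments of names, only the six permutations survive.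
      rcases hma with rfl | rfl | rfl <;> rcases hmb with rfl | rfl | rfl <;>
        rcases hmc with rfl | rfl | rfl <;> first
        | exact absurd rfl hab
        | exact absurd rfl hac
        | exact absurd rfl hbc
        | exact ⟨x, y, z, hxy, hyz, hxz, ha, hb, hc⟩
        | exact ⟨y, x, z, hxy.symm, hxz, hyz, ha.symm, hc.symm, hb.symm⟩
        | exact ⟨y, z, x, hyz, hxz.symm, hxy.symm, hb, hc, ha⟩
        | exact ⟨z, y, x, hyz.symm, hxy.symm, hxz.symm, hb.symm, ha.symm, hc.symm⟩
        | exact ⟨z, x, y, hxz.symm, hxy, hyz.symm, hc, ha, hb⟩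
        | exact ⟨x, z, y, hxz, hyz.symm, hxy, hc.symm, hb.symm, ha.symm⟩
    · omega
  rcases hC with hC | ⟨hC, -⟩
  · exact Or.inl (htri (Ω.isCycleSet_of_balanced _ hC))
  by_cases hcyc : Ω.graph.IsCycleSet {a, b, c}
  · exact Or.inl (htri hcyc)
  refine Or.inr ?_
  obtain ⟨-, hconn, C₁, C₂, hne, h₁, h₂, h₁C, h₂C⟩ := hC.prop
  -- Each of the two cycles is now a loop or a digon. A digon, or two loops at different vertices,
  -- already fixes the pair of vertices for the third edge.
  have hne₁ : C₁ ≠ {a, b, c} := fun h => hcyc (h ▸ h₁)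
  have hne₂ : C₂ ≠ {a, b, c} := fun h => hcyc (h ▸ h₂)
  have hthird : ∀ e ∈ ({a, b, c} : Set β), ∀ f ∈ ({a, b, c} : Set β), e ≠ f →
      ∃ g, ({a, b, c} : Set β) = {e, f, g} := by
    rintro e (rfl | rfl | rfl) f (rfl | rfl | rfl) hef
    · exact absurd rfl hef
    · exact ⟨c, rfl⟩
    · exact ⟨b, by rw [Set.pair_comm]⟩
    · exact ⟨c, Set.insert_comm _ _ _⟩
    · exact absurd rfl hef
    · exact ⟨a, by rw [Set.insert_comm, Set.pair_comm a]⟩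
    · exact ⟨b, by rw [Set.pair_comm, Set.insert_comm]⟩
    · exact ⟨a, by rw [Set.pair_comm, Set.insert_comm, Set.pair_comm a, Set.insert_comm]⟩
    · exact absurd rfl hef
  have hfin : ∀ x y, (∀ e ∈ ({a, b, c} : Set β), Ω.graph.IsWithin e x y) →
      ∃ x y, Ω.graph.IsWithin a x y ∧ Ω.graph.IsWithin b x y ∧ Ω.graph.IsWithin c x y :=
    fun x y h => ⟨x, y, h a (by simp), h b (by simp), h c (by simp)⟩
  have hdigon : ∀ e f x y, x ≠ y → e ≠ f → Ω.graph.IsLink e x y → Ω.graph.IsLink f x y →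
      {e, f} ⊆ ({a, b, c} : Set β) → ∀ D, Ω.graph.IsCycleSet D → D ⊆ {a, b, c} → D ≠ {a, b, c} →
      D ≠ {e, f} →
      ∃ x y, Ω.graph.IsWithin a x y ∧ Ω.graph.IsWithin b x y ∧ Ω.graph.IsWithin c x y := by
    intro e f x y hxy hef he hf hsub D hD hDX hDne hDne'
    obtain ⟨g, hg⟩ := hthird e (hsub (by simp)) f (hsub (by simp)) hef
    refine hfin x y ?_
    rw [hg] at hconn hDX hDne ⊢
    rintro d (rfl | rfl | rfl)
    · exact Or.inr (Or.inl he)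
    · exact Or.inr (Or.inl hf)
    · exact isWithin_of_digon hxy hconn he hf hD hDX hDne' hDne
  rcases h₁.cases_of_subset_triple h₁C hne₁ with
    ⟨e, x, he, rfl⟩ | ⟨e, f, x, y, hxy, hef, he, hf, rfl⟩
  · rcases h₂.cases_of_subset_triple h₂C hne₂ with
      ⟨f, y, hf, rfl⟩ | ⟨f, g, y, z, hyz, hfg, hf, hg, rfl⟩
    · have heX := h₁C rfl
      have hfX := h₂C rfl
      have hef : e ≠ f := fun h => hne (by rw [h])
      obtain ⟨g, hg⟩ := hthird e heX f hfX hef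
      have hpair : Ω.frameMatroid.Indep {e, f} := by
        rcases heX with rfl | rfl | rfl <;> rcases hfX with rfl | rfl | rfl <;> first
        | exact absurd rfl hef
        | assumption
        | (rw [Set.pair_comm]; assumption)
      have hxy : x ≠ y := by
        rintro rfl
        exact not_indep_loops hef he hf hpair
      refine hfin x y ?_
      rw [hg] at hconn hX ⊢
      rintro d (rfl | rfl | rfl)
      · exact Or.inl he
      · exact Or.inr (Or.inr hf)
      · exact isWithin_of_loops hxy (hX (by simp)) hconn he hf
    · exact hdigon f g y z hyz hfg hf hg h₂C _ h₁ h₁C hne₁ hne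
  · exact hdigon e f x y hxy hef he hf h₁C _ h₂ h₂C hne₂ hne.symm

end BiasedGraph

/-! ### Four-point lines -/

namespace BiasedGraph

variable {α β γ : Type*} {Ω : BiasedGraph α β}

open Graph

/-- Balanced sets are cycles, and a cycle with one edge is a loop, so `e` need not be assumed a
loop. -/
theorem NoBalancedLoops.singleton_notMem (h : Ω.NoBalancedLoops) (e : β) : {e} ∉ Ω.balanced := by
  intro he
  rcases (Ω.isCycleSet_of_balanced _ he).cases with ⟨d, x, hd, hed⟩ | ⟨d, f, x, y, -, hdf, -, -, hed⟩ |
    ⟨a, b, c, x, y, z, -, -, -, hab, -, -, -, -, -, hed⟩ | h4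
  · exact h d x hd (hed ▸ he)
  · exact hdf ((hed ▸ (by simp) : d ∈ ({e} : Set β)).trans
      (hed ▸ (by simp) : f ∈ ({e} : Set β)).symm)
  · exact hab ((hed ▸ (by simp) : a ∈ ({e} : Set β)).trans
      (hed ▸ (by simp) : b ∈ ({e} : Set β)).symm)
  · rw [Set.ncard_singleton] at h4
    omega

/-- A triangle is not contained in a four-point line. -/
theorem not_triangle_of_line {S : Set β}
    (hpair : ∀ e ∈ S, ∀ f ∈ S, e ≠ f → Ω.frameMatroid.Indep {e, f})
    (htriple : ∀ e ∈ S, ∀ f ∈ S, ∀ g ∈ S, e ≠ f → e ≠ g → f ≠ g →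
      ¬ Ω.frameMatroid.Indep {e, f, g})
    {a b c d : β} (ha : a ∈ S) (hb : b ∈ S) (hc : c ∈ S) (hd : d ∈ S)
    (hab : a ≠ b) (hac : a ≠ c) (had : a ≠ d) (hbd : b ≠ d) (hcd : c ≠ d)
    {x y z : α} (hxy : x ≠ y) (hyz : y ≠ z) (hxz : x ≠ z)
    (hla : Ω.graph.IsLink a x y) (hlb : Ω.graph.IsLink b y z) (hlc : Ω.graph.IsLink c z x) :
    False := by
  have hthree : ∀ e f p q r s t, Ω.graph.IsLink e p q → Ω.graph.IsLink f q r → p ≠ q → q ≠ r →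
      p ≠ r → Ω.graph.IsWithin e s t → ¬ Ω.graph.IsWithin f s t := by
    intro e f p q r s t he hf hpq hqr hpr hes hfs
    have h₁ := hes.eq_or_eq he.inc_left
    have h₂ := hes.eq_or_eq he.inc_right
    have h₃ := hfs.eq_or_eq hf.inc_right
    grind
  -- With `a` and `b`, the edge `d` must complete a triangle as `c` does, so `d` is a link between
  -- the ends of `c`. Then `{a, c, d}` is neither a triangle nor on two vertices.
  have hld : Ω.graph.IsLink d z x := by
    rcases cases_of_not_indep_triple hab had hbd (hpair a ha b hb hab) (hpair a ha d hd had)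
      (hpair b hb d hd hbd) (htriple a ha b hb d hd hab had hbd) with
      ⟨x', y', z', hxy', hyz', hxz', ha', hb', hd'⟩ | ⟨p, q, hap, hbp, -⟩
    · have h₁ := ha'.eq_and_eq_or_eq_and_eq hla
      have h₂ := hb'.eq_and_eq_or_eq_and_eq hlb
      have h₃ : x' = x ∧ z' = z := by grind
      rwa [h₃.1, h₃.2] at hd'
    · exact absurd hbp (hthree a b _ _ _ _ _ hla hlb hxy hyz hxz hap)
  rcases cases_of_not_indep_triple hac had hcd (hpair a ha c hc hac) (hpair a ha d hd had)
    (hpair c hc d hd hcd) (htriple a ha c hc d hd hac had hcd) with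
    ⟨x', y', z', hxy', hyz', hxz', -, hc', hd'⟩ | ⟨p, q, hap, hcp, -⟩
  · have h₁ := hc'.eq_and_eq_or_eq_and_eq hlc
    have h₂ := hd'.eq_and_eq_or_eq_and_eq hld
    grind
  · exact absurd hap (hthree c a _ _ _ _ _ hlc hla hxz.symm hxy hyz.symm hcp)

/-- The elements of a four-point line are edges on two vertices. -/
theorem isWithin_of_line {S : Set β}
    (hpair : ∀ e ∈ S, ∀ f ∈ S, e ≠ f → Ω.frameMatroid.Indep {e, f})
    (htriple : ∀ e ∈ S, ∀ f ∈ S, ∀ g ∈ S, e ≠ f → e ≠ g → f ≠ g →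
      ¬ Ω.frameMatroid.Indep {e, f, g})
    {a b c d : β} (ha : a ∈ S) (hb : b ∈ S) (hc : c ∈ S) (hd : d ∈ S)
    (hab : a ≠ b) (hac : a ≠ c) (had : a ≠ d) (hbc : b ≠ c) (hbd : b ≠ d) (hcd : c ≠ d) :
    ∃ x y, Ω.graph.IsWithin a x y ∧ Ω.graph.IsWithin b x y := by
  rcases cases_of_not_indep_triple hab hac hbc (hpair a ha b hb hab) (hpair a ha c hc hac)
    (hpair b hb c hc hbc) (htriple a ha b hb c hc hab hac hbc) with
    ⟨x, y, z, hxy, hyz, hxz, hla, hlb, hlc⟩ | ⟨x, y, hax, hbx, -⟩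
  · exact (not_triangle_of_line hpair htriple ha hb hc hd hab hac had hbd hcd
      hxy hyz hxz hla hlb hlc).elim
  · exact ⟨x, y, hax, hbx⟩

variable {Ω' : BiasedGraph γ β}

/-- Two loops at distinct vertices and an unbalanced digon on these vertices form a four-point line,
so in every frame representation of their matroid the loops lie on two vertices. -/
theorem isWithin_of_loops_of_digon (hbal : Ω.NoBalancedLoops)
    (hM : ∀ X ⊆ Ω.graph.edgeSet, Ω'.frameMatroid.Indep X ↔ Ω.frameMatroid.Indep X)
    {w w' : α} (hd : Ω.HasUnbalancedDigon w w') {i k : β}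
    (hi : Ω.graph.IsLink i w w) (hk : Ω.graph.IsLink k w' w') :
    ∃ x y, Ω'.graph.IsWithin i x y ∧ Ω'.graph.IsWithin k x y := by
  obtain ⟨hww, e, f, hef, he, hf, hefb⟩ := hd
  have hnl : ∀ d p, Ω.graph.IsLink d w w' → ¬ Ω.graph.IsLink d p p := by
    intro d p h h'
    rcases h.eq_and_eq_or_eq_and_eq h' with h | h <;> exact hww (h.1.trans h.2.symm)
  have hik : i ≠ k := by
    rintro rfl
    exact hww ((hi.left_eq_or_eq hk).elim id id)
  have hie : i ≠ e := fun h => hnl e w he (h ▸ hi)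
  have hif : i ≠ f := fun h => hnl f w hf (h ▸ hi)
  have hke : k ≠ e := fun h => hnl e w' he (h ▸ hk)
  have hkf : k ≠ f := fun h => hnl f w' hf (h ▸ hk)
  have hwithin : ∀ d ∈ ({i, k, e, f} : Set β), Ω.graph.IsWithin d w w' := by
    rintro d (rfl | rfl | rfl | rfl)
    · exact Or.inl hi
    · exact Or.inr (Or.inr hk)
    · exact Or.inr (Or.inl he)
    · exact Or.inr (Or.inl hf)
  -- A dependent pair is a pair of loops at one vertex or a balanced digon. The loops here have
  -- distinct vertices, and the only digon is `{e, f}`, which is unbalanced.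
  have hindep : ∀ d ∈ ({i, k, e, f} : Set β), ∀ d' ∈ ({i, k, e, f} : Set β), d ≠ d' →
      Ω.frameMatroid.Indep {d, d'} := by
    intro d hd d' hd' hdd
    by_contra hcon
    rcases cases_of_not_indep_pair hdd
      (Set.pair_subset (hwithin d hd).edge_mem (hwithin d' hd').edge_mem)
      (hbal.singleton_notMem d) (hbal.singleton_notMem d') hcon with ⟨x, h, h'⟩ | ⟨x, y, hxy, h, h', hb⟩
    · rcases hd with rfl | rfl | rfl | rfl
      · rcases hd' with rfl | rfl | rfl | rfl
        · exact hdd rfl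
        · exact hww (((hi.left_eq_or_eq h).elim id id).trans ((hk.left_eq_or_eq h').elim id id).symm)
        · exact hnl _ _ he h'
        · exact hnl _ _ hf h'
      · rcases hd' with rfl | rfl | rfl | rfl
        · exact hww (((hi.left_eq_or_eq h').elim id id).trans ((hk.left_eq_or_eq h).elim id id).symm)
        · exact hdd rfl
        · exact hnl _ _ he h'
        · exact hnl _ _ hf h'
      · exact hnl _ _ he h
      · exact hnl _ _ hf h
    · have hloop : ∀ d p, Ω.graph.IsLink d p p → ¬ Ω.graph.IsLink d x y := by
        intro d p h h'
        rcases h'.eq_and_eq_or_eq_and_eq h with h | h <;> exact hxy (h.1.trans h.2.symm)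
      rcases hd with rfl | rfl | rfl | rfl
      · exact hloop _ _ hi h
      · exact hloop _ _ hk h
      · rcases hd' with rfl | rfl | rfl | rfl
        · exact hloop _ _ hi h'
        · exact hloop _ _ hk h'
        · exact hdd rfl
        · exact hefb hb
      · rcases hd' with rfl | rfl | rfl | rfl
        · exact hloop _ _ hi h'
        · exact hloop _ _ hk h'
        · exact hefb (Set.pair_comm _ _ ▸ hb)
        · exact hdd rfl
  refine isWithin_of_line (S := {i, k, e, f}) ?_ ?_ (a := i) (b := k) (c := e) (d := f)
    (by simp) (by simp) (by simp) (by simp) hik hie hif hke hkf hef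
  · intro d hd d' hd' hdd
    exact (hM _ (Set.pair_subset (hwithin d hd).edge_mem (hwithin d' hd').edge_mem)).2
      (hindep d hd d' hd' hdd)
  · intro d hd d' hd' d'' hd'' h₁ h₂ h₃ hI
    refine not_indep_of_isWithin h₁ h₂ h₃ (hwithin d hd) (hwithin d' hd') (hwithin d'' hd'')
      ((hM _ ?_).1 hI)
    exact Set.insert_subset (hwithin d hd).edge_mem
      (Set.pair_subset (hwithin d' hd').edge_mem (hwithin d'' hd'').edge_mem)

end BiasedGraph

/-! ### Embedding the graph in a frame representation of its matroid -/

namespace BiasedGraph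

variable {α β γ : Type*} {Ω : BiasedGraph α β} {Ω' : BiasedGraph γ β}

open Graph

theorem singleton_notMem_balanced_of_indep {e : β} (h : Ω.frameMatroid.Indep {e}) :
    {e} ∉ Ω.balanced := fun he => h.2 _ (Or.inl he) subset_rfl

theorem indep_singleton_of_isLink (hbal : Ω.NoBalancedLoops) {e : β} {x : α}
    (he : Ω.graph.IsLink e x x) : Ω.frameMatroid.Indep {e} := by
  refine indep_of_loops ?_ (fun e _ => hbal.singleton_notMem e) ?_
  · rintro _ rfl
    exact ⟨x, he⟩
  · rintro _ rfl _ rfl - - -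
    rfl

/-- An edge parallel to a loop is a loop at the same vertex. -/
theorem isLink_of_not_indep_pair (hbal : Ω.NoBalancedLoops) {e f : β} {x : α}
    (he : Ω.graph.IsLink e x x) (hf : f ∈ Ω.graph.edgeSet)
    (h : f = e ∨ ¬ Ω.frameMatroid.Indep {e, f}) : Ω.graph.IsLink f x x := by
  rcases eq_or_ne f e with rfl | hne
  · exact he
  rcases cases_of_not_indep_pair hne.symm (Set.pair_subset he.edge_mem hf)
    (hbal.singleton_notMem e) (hbal.singleton_notMem f) (h.resolve_left hne) with
    ⟨y, hey, hfy⟩ | ⟨y, z, hyz, hey, -, -⟩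
  · rwa [(he.left_eq_or_eq hey).elim id id]
  · rcases hey.eq_and_eq_or_eq_and_eq he with h | h <;> exact absurd (h.1.trans h.2.symm) hyz

/-- A loop that lies on two neighbours by unbalanced digons is a loop in every frame representation
of the matroid. -/
theorem exists_isLoop (hbal : Ω.NoBalancedLoops)
    (hloop : ∀ w ∈ Ω.graph.vertexSet, ∃ e, Ω.IsUnbalancedLoopAt e w)
    (hdigon : ∀ w ∈ Ω.graph.vertexSet, ∃ w₁ w₂, w₁ ≠ w₂ ∧
      Ω.HasUnbalancedDigon w w₁ ∧ Ω.HasUnbalancedDigon w w₂)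
    (hM : ∀ X ⊆ Ω.graph.edgeSet, Ω'.frameMatroid.Indep X ↔ Ω.frameMatroid.Indep X)
    {w : α} {i : β} (hi : Ω.graph.IsLink i w w) : ∃ x, Ω'.graph.IsLink i x x := by
  obtain ⟨w₁, w₂, hne, h₁, h₂⟩ := hdigon w hi.left_mem
  obtain ⟨k₁, hk₁, -⟩ := hloop w₁ h₁.2.choose_spec.choose_spec.2.1.right_mem
  obtain ⟨k₂, hk₂, -⟩ := hloop w₂ h₂.2.choose_spec.choose_spec.2.1.right_mem
  obtain ⟨x, y, hix, hkx⟩ := isWithin_of_loops_of_digon hbal hM h₁ hi hk₁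
  obtain ⟨x', y', hix', hkx'⟩ := isWithin_of_loops_of_digon hbal hM h₂ hi hk₂
  obtain ⟨p, q, hpq⟩ := exists_isLink_of_mem_edgeSet hix.edge_mem
  -- If `i` were a link, its ends would fix the vertex pair of both lines, making `{i, k₁, k₂}`
  -- dependent, against the independence of loops at three distinct vertices.
  rcases eq_or_ne p q with rfl | hne'
  · exact ⟨p, hpq⟩
  have hdist : ∀ e f a b, Ω.graph.IsLink e a a → Ω.graph.IsLink f b b → a ≠ b → e ≠ f := by
    rintro e f a b he hf hab rfl
    exact hab ((he.left_eq_or_eq hf).elim id id)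
  refine (not_indep_of_isWithin (hdist _ _ _ _ hi hk₁ h₁.1) (hdist _ _ _ _ hi hk₂ h₂.1)
    (hdist _ _ _ _ hk₁ hk₂ hne) (Or.inr (Or.inl hpq)) (hix.of_isLink hne' hpq hkx)
    (hix'.of_isLink hne' hpq hkx') ((hM _ ?_).2 ?_)).elim
  · rintro e (rfl | rfl | rfl)
    exacts [hi.edge_mem, hk₁.edge_mem, hk₂.edge_mem]
  · have hlk : ∀ e ∈ ({i, k₁, k₂} : Set β), ∀ x, Ω.graph.IsLink e x x →
        (e = i ∧ x = w) ∨ (e = k₁ ∧ x = w₁) ∨ (e = k₂ ∧ x = w₂) := by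
      rintro e (rfl | rfl | rfl) x hx
      · exact Or.inl ⟨rfl, (hx.left_eq_or_eq hi).elim id id⟩
      · exact Or.inr (Or.inl ⟨rfl, (hx.left_eq_or_eq hk₁).elim id id⟩)
      · exact Or.inr (Or.inr ⟨rfl, (hx.left_eq_or_eq hk₂).elim id id⟩)
    refine indep_of_loops ?_ (fun e _ => hbal.singleton_notMem e) ?_
    · rintro e (rfl | rfl | rfl)
      exacts [⟨_, hi⟩, ⟨_, hk₁⟩, ⟨_, hk₂⟩]
    · intro e he f hf x hex hfx
      have := h₁.1
      have := h₂.1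
      have := hlk e he x hex
      have := hlk f hf x hfx
      grind

/-- Every frame representation of the matroid has the same links, up to renaming the vertices. -/
theorem exists_embedding (hbal : Ω.NoBalancedLoops) (hne : Ω.graph.vertexSet.Nonempty)
    (hloop : ∀ w ∈ Ω.graph.vertexSet, ∃ e, Ω.IsUnbalancedLoopAt e w)
    (hdigon : ∀ w ∈ Ω.graph.vertexSet, ∃ w₁ w₂, w₁ ≠ w₂ ∧
      Ω.HasUnbalancedDigon w w₁ ∧ Ω.HasUnbalancedDigon w w₂)
    (hM : ∀ X ⊆ Ω.graph.edgeSet, Ω'.frameMatroid.Indep X ↔ Ω.frameMatroid.Indep X) :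
    ∃ φ : α → γ, ∀ e p q, Ω.graph.IsLink e p q → Ω'.graph.IsLink e (φ p) (φ q) := by
  have hnb : ∀ e w, Ω.graph.IsLink e w w → {e} ∉ Ω'.balanced := fun e w he =>
    singleton_notMem_balanced_of_indep
      ((hM _ (Set.singleton_subset_iff.2 he.edge_mem)).2 (indep_singleton_of_isLink hbal he))
  have hex : ∀ w ∈ Ω.graph.vertexSet, ∃ x, ∀ e, Ω.graph.IsLink e w w → Ω'.graph.IsLink e x x := by
    intro w hw
    obtain ⟨i, hi, -⟩ := hloop w hw
    obtain ⟨x, hx⟩ := exists_isLoop hbal hloop hdigon hM hi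
    refine ⟨x, fun e he => ?_⟩
    obtain ⟨y, hy⟩ := exists_isLoop hbal hloop hdigon hM he
    rcases eq_or_ne i e with rfl | hie
    · exact hx
    -- Loops at `w` are parallel, and this persists in `Ω'`; since `i` is a loop there, the pair is
    -- not a digon.
    have hdep : ¬ Ω'.frameMatroid.Indep {i, e} := fun h =>
      not_indep_loops hie hi he ((hM _ (Set.pair_subset hi.edge_mem he.edge_mem)).1 h)
    rcases cases_of_not_indep_pair hie (Set.pair_subset hx.edge_mem hy.edge_mem) (hnb i w hi)
      (hnb e w he) hdep with ⟨z, hiz, hez⟩ | ⟨y, z, hyz, hiy, -, -⟩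
    · rwa [(hx.left_eq_or_eq hiz).elim id id]
    · rcases hiy.eq_and_eq_or_eq_and_eq hx with h | h <;> exact absurd (h.1.trans h.2.symm) hyz
  have : Nonempty γ := hne.elim fun w hw => ⟨(hex w hw).choose⟩
  choose! φ hφ using hex
  refine ⟨φ, fun e p q he => ?_⟩
  rcases eq_or_ne p q with rfl | hpq
  · exact hφ p he.left_mem e he
  obtain ⟨i, hi, -⟩ := hloop p he.left_mem
  obtain ⟨k, hk, -⟩ := hloop q he.right_mem
  have hi' := hφ p he.left_mem i hi
  have hk' := hφ q he.right_mem k hk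
  have hpar : ∀ {j f r}, Ω.graph.IsLink j r r → f ∈ Ω.graph.edgeSet → ¬ Ω.graph.IsLink f r r →
      Ω'.frameMatroid.Indep {j, f} := by
    intro j f r hj hf hfr
    rw [hM _ (Set.pair_subset hj.edge_mem hf)]
    by_contra hcon
    exact hfr (isLink_of_not_indep_pair hbal hj hf (Or.inr hcon))
  have hnl : ∀ r, ¬ Ω.graph.IsLink e r r := by
    intro r h
    rcases he.eq_and_eq_or_eq_and_eq h with h | h <;> exact hpq (h.1.trans h.2.symm)
  have hie' := hpar hi he.edge_mem (hnl p)
  have hke' := hpar hk he.edge_mem (hnl q)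
  have hik' := hpar hi hk.edge_mem fun h => hpq ((h.left_eq_or_eq hk).elim id id)
  have hie : i ≠ e := fun h => hnl p (h ▸ hi)
  have hke : k ≠ e := fun h => hnl q (h ▸ hk)
  have hik : i ≠ k := by
    rintro rfl
    exact hpq ((hi.left_eq_or_eq hk).elim id id)
  -- The triple is dependent with independent pairs. The loop `i` rules out a triangle, so `e` lies
  -- on `φ p`, `φ q`; it is not a loop there, being parallel to neither `i` nor `k`.
  have hdep : ¬ Ω'.frameMatroid.Indep {i, k, e} := by
    rw [hM _ (Set.insert_subset hi.edge_mem (Set.pair_subset hk.edge_mem he.edge_mem))]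
    exact not_indep_of_isWithin hik hie hke (Or.inl hi) (Or.inr (Or.inr hk)) (Or.inr (Or.inl he))
  rcases cases_of_not_indep_triple hik hie hke hik' hie' hke' hdep with
    ⟨x, y, z, hxy, -, -, hx, -, -⟩ | ⟨x, y, hix, hkx, hex⟩
  · rcases hx.eq_and_eq_or_eq_and_eq hi' with h | h <;> exact absurd (h.1.trans h.2.symm) hxy
  have hne' : φ p ≠ φ q := fun h => not_indep_loops hik hi' (h ▸ hk') hik'
  have h₁ := hix.eq_or_eq hi'.inc_left
  have h₂ := hkx.eq_or_eq hk'.inc_left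
  have hw : Ω'.graph.IsWithin e (φ p) (φ q) := by
    rcases h₁ with h₁ | h₁ <;> rcases h₂ with h₂ | h₂
    · exact absurd (h₁.trans h₂.symm) hne'
    · rwa [h₁, h₂]
    · rw [h₁, h₂]
      exact hex.symm
    · exact absurd (h₁.trans h₂.symm) hne'
  rcases hw with h | h | h
  · exact absurd hie' (not_indep_loops hie hi' h)
  · exact h
  · exact absurd hke' (not_indep_loops hke hk' h)

end BiasedGraph

/-! ### Comparing the two embeddings -/

namespace BiasedGraph

variable {α β γ : Type*} {Ω : BiasedGraph α β} {Ω' : BiasedGraph γ β}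

open Graph

/-- Loops at `p` and `q` sent to one vertex are equal or parallel in `Ω'`, hence also in `Ω`. -/
theorem embedding_injOn (hbal : Ω.NoBalancedLoops)
    (hloop : ∀ w ∈ Ω.graph.vertexSet, ∃ e, Ω.IsUnbalancedLoopAt e w)
    (hM : ∀ X ⊆ Ω.graph.edgeSet, Ω'.frameMatroid.Indep X ↔ Ω.frameMatroid.Indep X)
    {φ : α → γ} (hφ : ∀ e p q, Ω.graph.IsLink e p q → Ω'.graph.IsLink e (φ p) (φ q)) :
    Set.InjOn φ Ω.graph.vertexSet := by
  intro p hp q hq h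
  obtain ⟨i, hi, -⟩ := hloop p hp
  obtain ⟨k, hk, -⟩ := hloop q hq
  have hki : Ω.graph.IsLink k p p := by
    refine isLink_of_not_indep_pair hbal hi hk.edge_mem ?_
    by_contra! hcon
    exact not_indep_loops hcon.1.symm (hφ i p p hi) (h ▸ hφ k q q hk)
      ((hM _ (Set.pair_subset hi.edge_mem hk.edge_mem)).2 hcon.2)
  exact (hki.left_eq_or_eq hk).elim id id

variable {Ω₁ Ω₂ : BiasedGraph α β}

/-- Here the rank formula of the proper amalgam matters: without an element of `ℓ` parallel to both
loops, they would be independent in `Ω'`. That element is a loop at `p` in one graph and at `q` in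
the other. -/
theorem embedding_eq_of_eq (hfin₁ : Ω₁.graph.edgeSet.Finite) (hfin₂ : Ω₂.graph.edgeSet.Finite)
    (hbal₁ : Ω₁.NoBalancedLoops) (hbal₂ : Ω₂.NoBalancedLoops)
    (hcompat : Ω₁.graph.Compatible Ω₂.graph)
    (hN : Ω₁.frameMatroid.restrict (Ω₁.graph.edgeSet ∩ Ω₂.graph.edgeSet) =
      Ω₂.frameMatroid.restrict (Ω₁.graph.edgeSet ∩ Ω₂.graph.edgeSet))
    (hloop₁ : ∀ w ∈ Ω₁.graph.vertexSet, ∃ e, Ω₁.IsUnbalancedLoopAt e w)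
    (hloop₂ : ∀ w ∈ Ω₂.graph.vertexSet, ∃ e, Ω₂.IsUnbalancedLoopAt e w)
    (hF : SetSystem.properAmalgam Ω₁.frameMatroid Ω₂.frameMatroid = Ω'.frameMatroid)
    {φ₁ φ₂ : α → γ} (hφ₁ : ∀ e p q, Ω₁.graph.IsLink e p q → Ω'.graph.IsLink e (φ₁ p) (φ₁ q))
    (hφ₂ : ∀ e p q, Ω₂.graph.IsLink e p q → Ω'.graph.IsLink e (φ₂ p) (φ₂ q))
    {p q : α} (hp : p ∈ Ω₁.graph.vertexSet) (hq : q ∈ Ω₂.graph.vertexSet) (h : φ₁ p = φ₂ q) :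
    p = q := by
  obtain ⟨i, hi, -⟩ := hloop₁ p hp
  obtain ⟨k, hk, -⟩ := hloop₂ q hq
  rcases eq_or_ne i k with rfl | hik
  · exact ((IsLink.of_compatible hcompat hk.edge_mem hi).left_eq_or_eq hk).elim id id
  have hdep : ¬ (SetSystem.properAmalgam Ω₁.frameMatroid Ω₂.frameMatroid).Indep {i, k} := by
    rw [hF]
    exact not_indep_loops hik (hφ₁ i p p hi) (h ▸ hφ₂ k q q hk)
  obtain ⟨z, ⟨hz₁, hz₂⟩, h₁, h₂⟩ := SetSystem.exists_parallel_of_not_indep_properAmalgam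
    hfin₁ hfin₂ Ω₁.frameMatroid_indep_empty Ω₂.frameMatroid_indep_empty hN
    (indep_singleton_of_isLink hbal₁ hi) (indep_singleton_of_isLink hbal₂ hk) hik hdep
  have hzp := isLink_of_not_indep_pair hbal₁ hi hz₁ h₁
  have hzq := isLink_of_not_indep_pair hbal₂ hk hz₂ h₂
  exact ((IsLink.of_compatible hcompat hz₂ hzp).left_eq_or_eq hzq).elim id id

/-- If the common edges have rank two, then the embeddings of the two graphs agree on the common
vertices. -/
theorem embedding_agree (hfin₁ : Ω₁.graph.edgeSet.Finite)
    {u v : α} (huv : u ≠ v) (hV : Ω₁.graph.vertexSet ∩ Ω₂.graph.vertexSet = {u, v})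
    (hcompat : Ω₁.graph.Compatible Ω₂.graph)
    (hrank : Ω₁.frameMatroid.rank (Ω₁.graph.edgeSet ∩ Ω₂.graph.edgeSet) = 2)
    {φ₁ φ₂ : α → γ} (hφ₁ : ∀ e p q, Ω₁.graph.IsLink e p q → Ω'.graph.IsLink e (φ₁ p) (φ₁ q))
    (hφ₂ : ∀ e p q, Ω₂.graph.IsLink e p q → Ω'.graph.IsLink e (φ₂ p) (φ₂ q))
    (hcross : ∀ p ∈ Ω₁.graph.vertexSet, ∀ q ∈ Ω₂.graph.vertexSet, φ₁ p = φ₂ q → p = q) :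
    φ₁ u = φ₂ u ∧ φ₁ v = φ₂ v := by
  have hu : u ∈ Ω₁.graph.vertexSet ∩ Ω₂.graph.vertexSet := hV ▸ Or.inl rfl
  have hv : v ∈ Ω₁.graph.vertexSet ∩ Ω₂.graph.vertexSet := hV ▸ Or.inr rfl
  have hagree : ∀ e x, e ∈ Ω₂.graph.edgeSet → Ω₁.graph.IsLink e x x → φ₁ x = φ₂ x :=
    fun e x he hx => ((hφ₁ e x x hx).left_eq_or_eq
      (hφ₂ e x x (IsLink.of_compatible hcompat he hx))).elim id id
  -- A common link `uv` fixes the images up to a swap, which `hcross` forbids. Otherwise all common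
  -- edges are loops at `u` or `v`, and two independent ones lie at different vertices.
  by_cases hlink : ∃ e ∈ Ω₂.graph.edgeSet, Ω₁.graph.IsLink e u v
  · obtain ⟨e, he, hl⟩ := hlink
    rcases (hφ₁ e u v hl).eq_and_eq_or_eq_and_eq
      (hφ₂ e u v (IsLink.of_compatible hcompat he hl)) with h | h
    · exact h
    · exact absurd (hcross u hu.1 v hv.2 h.1) huv
  · have hends : ∀ e ∈ Ω₁.graph.edgeSet ∩ Ω₂.graph.edgeSet,
        Ω₁.graph.IsLink e u u ∨ Ω₁.graph.IsLink e v v := by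
      rintro e ⟨he₁, he₂⟩
      obtain ⟨p, q, hpq⟩ := exists_isLink_of_mem_edgeSet he₁
      have hpq₂ := IsLink.of_compatible hcompat he₂ hpq
      have hp : p ∈ ({u, v} : Set α) := hV ▸ ⟨hpq.left_mem, hpq₂.left_mem⟩
      have hq : q ∈ ({u, v} : Set α) := hV ▸ ⟨hpq.right_mem, hpq₂.right_mem⟩
      rcases hp with rfl | rfl <;> rcases hq with rfl | rfl
      · exact Or.inl hpq
      · exact absurd ⟨e, he₂, hpq⟩ hlink
      · exact absurd ⟨e, he₂, hpq.symm⟩ hlink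
      · exact Or.inr hpq
    obtain ⟨I, hIℓ, hI, hcard⟩ := SetSystem.exists_indep_ncard_eq_rank (M := Ω₁.frameMatroid)
      hfin₁ Ω₁.frameMatroid_indep_empty (Ω₁.graph.edgeSet ∩ Ω₂.graph.edgeSet)
    rw [hrank] at hcard
    obtain ⟨a, b, hab, rfl⟩ := Set.ncard_eq_two.1 hcard
    have ha := hIℓ (Or.inl rfl)
    have hb := hIℓ (Or.inr rfl)
    rcases hends a ha with hau | hav <;> rcases hends b hb with hbu | hbv
    · exact absurd hI (not_indep_loops hab hau hbu)
    · exact ⟨hagree a u ha.2 hau, hagree b v hb.2 hbv⟩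
    · exact ⟨hagree b u hb.2 hbu, hagree a v ha.2 hav⟩
    · exact absurd hI (not_indep_loops hab hav hbv)

end BiasedGraph

/-! ### Assembling the isomorphism -/

/-- An injective map of vertices that preserves the links gives an isomorphism if the edge sets are
the same and there are no isolated vertices. -/
theorem Graph.nonempty_graphIso_of_embedding {α β γ : Type*} {G : Graph α β} {H : Graph γ β}
    (hE : H.edgeSet = G.edgeSet) (hiso : ¬ H.HasIsolatedVertex) {φ : α → γ}
    (hinj : Set.InjOn φ G.vertexSet) (hmem : ∀ x ∈ G.vertexSet, φ x ∈ H.vertexSet)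
    (hφ : ∀ e p q, G.IsLink e p q → H.IsLink e (φ p) (φ q)) :
    Nonempty (GraphIso H G) := by
  have hbij : Function.Bijective (fun x : G.vertexSet => (⟨φ x, hmem x x.2⟩ : H.vertexSet)) := by
    constructor
    · intro x y h
      exact Subtype.ext (hinj x.2 y.2 (congrArg Subtype.val h))
    · rintro ⟨y, hy⟩
      -- An edge at `y` is also an edge of `G`, and its ends in `H` are images under `φ`.
      obtain ⟨e, he⟩ : ∃ e, H.Inc e y := by
        by_contra! hcon
        exact hiso ⟨y, hy, hcon⟩
      obtain ⟨p, q, hpq⟩ := G.exists_isLink_of_mem_edgeSet (hE ▸ he.edge_mem)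
      rcases he.eq_or_eq_of_isLink (hφ e p q hpq) with rfl | rfl
      · exact ⟨⟨p, hpq.left_mem⟩, rfl⟩
      · exact ⟨⟨q, hpq.right_mem⟩, rfl⟩
  refine ⟨(Equiv.ofBijective _ hbij).symm, Equiv.setCongr hE, ?_⟩
  intro e x
  obtain ⟨x, rfl⟩ := (Equiv.ofBijective _ hbij).surjective x
  rw [Equiv.symm_apply_apply]
  obtain ⟨e, he⟩ := e
  change H.Inc e (φ x) ↔ G.Inc e x
  obtain ⟨p, q, hpq⟩ := G.exists_isLink_of_mem_edgeSet (hE ▸ he)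
  constructor
  · intro h
    rcases h.eq_or_eq_of_isLink (hφ e p q hpq) with h | h
    · rw [hinj x.2 hpq.left_mem h]
      exact hpq.inc_left
    · rw [hinj x.2 hpq.right_mem h]
      exact hpq.inc_right
  · rintro ⟨y, hy⟩
    exact ⟨φ y, hφ e x y hy⟩

theorem mainTheorem8 {α β γ : Type*}
    (Ω₁ Ω₂ : BiasedGraph α β)
    -- the graphs are finite (every vertex carries a loop, so finitely many edges suffice)
    (hfin₁ : Ω₁.graph.edgeSet.Finite) (hfin₂ : Ω₂.graph.edgeSet.Finite)
    (hbal₁ : Ω₁.NoBalancedLoops) (hbal₂ : Ω₂.NoBalancedLoops)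
    (u v : α) (huv : u ≠ v)
    (hV : Ω₁.graph.vertexSet ∩ Ω₂.graph.vertexSet = {u, v})
    -- the common edges have the same ends in both graphs, so that the glued graph is defined
    (hcompat : Ω₁.graph.Compatible Ω₂.graph)
    -- the two frame matroids have the same restriction to the amalgam base, which has rank two
    (hN : Ω₁.frameMatroid.restrict (Ω₁.graph.edgeSet ∩ Ω₂.graph.edgeSet) =
      Ω₂.frameMatroid.restrict (Ω₁.graph.edgeSet ∩ Ω₂.graph.edgeSet))
    (hrank : Ω₁.frameMatroid.rank (Ω₁.graph.edgeSet ∩ Ω₂.graph.edgeSet) = 2)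
    (hloop₁ : ∀ w ∈ Ω₁.graph.vertexSet, ∃ e, Ω₁.IsUnbalancedLoopAt e w)
    (hloop₂ : ∀ w ∈ Ω₂.graph.vertexSet, ∃ e, Ω₂.IsUnbalancedLoopAt e w)
    (hdigon₁ : ∀ w ∈ Ω₁.graph.vertexSet, ∃ w₁ w₂, w₁ ≠ w₂ ∧
      Ω₁.HasUnbalancedDigon w w₁ ∧ Ω₁.HasUnbalancedDigon w w₂)
    (hdigon₂ : ∀ w ∈ Ω₂.graph.vertexSet, ∃ w₁ w₂, w₁ ≠ w₂ ∧
      Ω₂.HasUnbalancedDigon w w₁ ∧ Ω₂.HasUnbalancedDigon w w₂)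
    (Ω : BiasedGraph γ β) (hiso : ¬ Ω.graph.HasIsolatedVertex)
    (hF : SetSystem.properAmalgam Ω₁.frameMatroid Ω₂.frameMatroid = Ω.frameMatroid) :
    Nonempty (GraphIso Ω.graph (Ω₁.graph.glue Ω₂.graph hcompat)) := by
  classical
  have hne₁ : Ω₁.graph.vertexSet.Nonempty := ⟨u, (hV ▸ Or.inl rfl :
    u ∈ Ω₁.graph.vertexSet ∩ Ω₂.graph.vertexSet).1⟩
  have hne₂ : Ω₂.graph.vertexSet.Nonempty := ⟨u, (hV ▸ Or.inl rfl :
    u ∈ Ω₁.graph.vertexSet ∩ Ω₂.graph.vertexSet).2⟩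
  have hM₁ : ∀ X ⊆ Ω₁.graph.edgeSet, Ω.frameMatroid.Indep X ↔ Ω₁.frameMatroid.Indep X := by
    intro X hX
    rw [← hF]
    exact SetSystem.properAmalgam_indep_iff_left hfin₁ hfin₂ Ω₁.frameMatroid_indep_empty
      Ω₂.frameMatroid_indep_empty hN hX
  have hM₂ : ∀ X ⊆ Ω₂.graph.edgeSet, Ω.frameMatroid.Indep X ↔ Ω₂.frameMatroid.Indep X := by
    intro X hX
    rw [← hF, SetSystem.properAmalgam_comm hN]
    refine SetSystem.properAmalgam_indep_iff_left hfin₂ hfin₁ Ω₂.frameMatroid_indep_empty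
      Ω₁.frameMatroid_indep_empty ?_ hX
    rw [Set.inter_comm]
    exact hN.symm
  obtain ⟨φ₁, hφ₁⟩ := BiasedGraph.exists_embedding hbal₁ hne₁ hloop₁ hdigon₁ hM₁
  obtain ⟨φ₂, hφ₂⟩ := BiasedGraph.exists_embedding hbal₂ hne₂ hloop₂ hdigon₂ hM₂
  have hinj₁ := BiasedGraph.embedding_injOn hbal₁ hloop₁ hM₁ hφ₁
  have hinj₂ := BiasedGraph.embedding_injOn hbal₂ hloop₂ hM₂ hφ₂
  have hcross : ∀ p ∈ Ω₁.graph.vertexSet, ∀ q ∈ Ω₂.graph.vertexSet, φ₁ p = φ₂ q → p = q :=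
    fun p hp q hq h => BiasedGraph.embedding_eq_of_eq hfin₁ hfin₂ hbal₁ hbal₂ hcompat hN
      hloop₁ hloop₂ hF hφ₁ hφ₂ hp hq h
  have hagree := BiasedGraph.embedding_agree hfin₁ huv hV hcompat hrank hφ₁ hφ₂ hcross
  let φ : α → γ := fun x => if x ∈ Ω₁.graph.vertexSet then φ₁ x else φ₂ x
  have hφ_left : ∀ x ∈ Ω₁.graph.vertexSet, φ x = φ₁ x := fun x hx => if_pos hx
  have hφ_right : ∀ x ∈ Ω₂.graph.vertexSet, φ x = φ₂ x := by
    intro x hx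
    by_cases hx₁ : x ∈ Ω₁.graph.vertexSet
    · rw [hφ_left x hx₁]
      rcases (hV ▸ ⟨hx₁, hx⟩ : x ∈ ({u, v} : Set α)) with rfl | rfl
      exacts [hagree.1, hagree.2]
    · exact if_neg hx₁
  refine Graph.nonempty_graphIso_of_embedding (φ := φ) (congrArg SetSystem.ground hF).symm hiso
    ?_ ?_ ?_
  · rintro p (hp | hp) q (hq | hq) h
    · rw [hφ_left p hp, hφ_left q hq] at h
      exact hinj₁ hp hq h
    · rw [hφ_left p hp, hφ_right q hq] at h
      exact hcross p hp q hq h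
    · rw [hφ_right p hp, hφ_left q hq] at h
      exact (hcross q hq p hp h.symm).symm
    · rw [hφ_right p hp, hφ_right q hq] at h
      exact hinj₂ hp hq h
  · rintro x (hx | hx)
    · obtain ⟨e, he, -⟩ := hloop₁ x hx
      rw [hφ_left x hx]
      exact (hφ₁ e x x he).left_mem
    · obtain ⟨e, he, -⟩ := hloop₂ x hx
      rw [hφ_right x hx]
      exact (hφ₂ e x x he).left_mem
  · rintro e p q (h | h)
    · rw [hφ_left p h.left_mem, hφ_left q h.right_mem]
      exact hφ₁ e p q h
    · rw [hφ_right p h.left_mem, hφ_right q h.right_mem]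
      exact hφ₂ e p q h
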